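/- Let $n, L\ge 1$, $\mathbb{R}_+=[0,\infty)$, and let $F=(f_1,\dots,f_L):\mathbb{R}_+^L\to\mathbb{R}_+^L$ be continuous on $\mathbb{R}_+^L$ and locally Lipschitz in the interior of $\mathbb{R}_+^L$. Assume that $F$ is non-degenerate: for every permutation $i_1,\dots,i_L$ of $1,\dots,L$, every $1\le k<L$ and every $u\in\mathbb{R}_+^L$ with $u_{i_1},\dots,u_{i_k}>0$ and $u_{i_{k+1}}=\dots=u_{i_L}=0$, one has $f_{i_{k+1}}(u)+\dots+f_{i_L}(u)>0$. Suppose that for no $R>0$ does the Dirichlet problem $$-\Delta u_i=f_i(u)\ \text{ in } B_R,\qquad u_i>0\ \text{ in } B_R,\qquad u_i=0\ \text{ on }\partial B_R\qquad (i=1,\dots,L)$$ on the ball $B_R=\{x\in\mathbb{R}^n : |x|<R\}$ have a radially symmetric classical solution $u\in C^2(B_R)\cap C(\overline{B_R})$. Then the system $$-\Delta u_i=f_i(u),\qquad u_i>0\quad\text{ in }\mathbb{R}^n\qquad (i=1,\dots,L)$$ has a radially symmetric classical solution $u\in C^2(\mathbb{R}^n)$. If in addition there is $\varepsilon>0$ such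 that $F(v)\ne 0$ for every $v$ with all components positive and $|v|<\varepsilon$, then this system has a radially symmetric classical solution $u(x)=u(|x|)$ with $u(r)\to 0$ as $r\to\infty$. -/

import Mathlib

open Set Filter Topology
open scoped Laplacian

/-- The closed orthant `ℝ₊^L`, where `ℝ₊ = [0, ∞)`. -/
def orthant (L : ℕ) : Set (Fin L → ℝ) := {v | ∀ i, 0 ≤ v i}

/-- `F` is non-degenerate: for every permutation `σ` of the indices, every `1 ≤ k < L` and every
`v ∈ ℝ₊^L` whose first `k` components (in the order given by `σ`) are positive and whose other
components vanish, the sum of the other components of `F v` is positive. -/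
def NonDegenerate {L : ℕ} (F : (Fin L → ℝ) → (Fin L → ℝ)) : Prop :=
  ∀ (σ : Equiv.Perm (Fin L)) (k : ℕ), 1 ≤ k → k < L → ∀ v ∈ orthant L,
    (∀ j : Fin L, (j : ℕ) < k → 0 < v (σ j)) →
    (∀ j : Fin L, k ≤ (j : ℕ) → v (σ j) = 0) →
    0 < ∑ j ∈ {j : Fin L | k ≤ (j : ℕ)}, F v (σ j)

/-- `u` is a (classical) solution of `-Δ uᵢ = fᵢ(u)`, `uᵢ > 0` in `ℝⁿ`. -/
structure IsEntireSolution {n L : ℕ} (F : (Fin L → ℝ) → (Fin L → ℝ))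
    (u : EuclideanSpace ℝ (Fin n) → (Fin L → ℝ)) : Prop where
  contDiff : ContDiff ℝ 2 u
  eqn : ∀ x i, -(Δ (fun y => u y i)) x = F (u x) i
  pos : ∀ x i, 0 < u x i

/-- `u` is a (classical) solution, of class `C²(B_R) ∩ C(closure B_R)`, of the Dirichlet problem
`-Δ uᵢ = fᵢ(u)`, `uᵢ > 0` in `B_R`, `uᵢ = 0` on `∂B_R`.
The values of `u` outside the closed ball are irrelevant. -/
structure IsDirichletSolution {n L : ℕ} (F : (Fin L → ℝ) → (Fin L → ℝ)) (R : ℝ)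
    (u : EuclideanSpace ℝ (Fin n) → (Fin L → ℝ)) : Prop where
  contDiffOn : ContDiffOn ℝ 2 u (Metric.ball 0 R)
  continuousOn : ContinuousOn u (Metric.closedBall 0 R)
  eqn : ∀ x ∈ Metric.ball (0 : EuclideanSpace ℝ (Fin n)) R, ∀ i,
    -(Δ (fun y => u y i)) x = F (u x) i
  pos : ∀ x ∈ Metric.ball (0 : EuclideanSpace ℝ (Fin n)) R, ∀ i, 0 < u x i
  boundary : ∀ x ∈ Metric.sphere (0 : EuclideanSpace ℝ (Fin n)) R, ∀ i, u x i = 0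

/-- The radially symmetric function `x ↦ w(|x|)` on `ℝⁿ` with profile `w`. -/
noncomputable def radial (n : ℕ) {L : ℕ} (w : ℝ → (Fin L → ℝ)) : EuclideanSpace ℝ (Fin n) → (Fin L → ℝ) :=
  fun x => w ‖x‖

/-!
The solution is found by shooting. A radial solution of `-Δuᵢ = fᵢ(u)` with `u(0) = α` has
nonincreasing components, so, starting in the orthant, it either stays there forever or leaves it
at a first radius. Non-degeneracy and the monotonicity of the components exclude that some but not
all components vanish before that radius (`IsShot.pos_or_eq_zero`); if all of them vanish at some
point, the solution is, up to there, a solution of the Dirichlet problem on a ball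
(`IsShot.exists_isDirichletSolution`), and if it stays in the orthant forever, it is an entire
positive solution.

Suppose that every solution with initial value in the simplex `{α ≥ 0, ∑ αᵢ = a}` leaves the
orthant, and let `Aᵢ` be the set of those `α` for which some solution starting at `α` reaches the
face `uᵢ = 0` while still in the orthant (`exitSet`). The `Aᵢ` cover the simplex, `Aᵢ` contains
the face `αᵢ = 0`, and `Aᵢ` is closed by compactness of the set of solutions
(`isClosed_exitSet`); neither uniqueness nor continuity of the exit point in `α` is needed for
this. By the dual form of the Knaster–Kuratowski–Mazurkiewicz lemma
(`exists_mem_all_of_closed_cover`) some `α` lies in all `Aᵢ`. As `F` is locally Lipschitz in the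
interior, the corresponding solutions agree until the first of them vanishes in some component,
and all components vanish simultaneously there: a solution of the Dirichlet problem, which was
excluded. So some `α` in each simplex yields an entire solution. Its limit at infinity is a zero
of `F` in the box `[0, a]^L` (`IsShot.exists_tendsto`); by non-degeneracy and, for small `a`, the
additional condition, this zero can only be the origin.

The covering lemma rests on Brouwer's fixed point theorem, proved here after Milnor and Rogers:
for a `C¹` retraction `r` of the ball onto the sphere, the integral of `det (1 + t (Dr - 1))` over
the ball is polynomial in `t`, equal to the volume of the ball for small `t > 0`, and zero at
`t = 1`. The initial value problem is treated in integral form, with the derivative of the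
profile written as `-s ∫₀¹ θ^(n-1) g(sθ) dθ`, which has no singularity at the origin; existence is
by delays and the Arzelà–Ascoli theorem, since `F` need not be Lipschitz up to the boundary.
-/

/-! ### Brouwer's fixed point theorem -/

section Brouwer

open MeasureTheory Metric

variable {E : Type*} [NormedAddCommGroup E] [InnerProductSpace ℝ E] [FiniteDimensional ℝ E]

/-- `t ↦ det (1 + t A)` is a polynomial of degree at most `dim E`, so its value at `1` is a
combination of its values at finitely many small `t`, with weights that do not depend on `A`. -/
lemma exists_weights_det_one_add {δ : ℝ} (hδ : 0 < δ) :
    ∃ (m : ℕ) (t c : ℕ → ℝ), (∀ j < m, 0 < t j ∧ t j ≤ δ) ∧ ∑ j ∈ Finset.range m, c j = 1 ∧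
      ∀ A : E →L[ℝ] E, (1 + A).det = ∑ j ∈ Finset.range m, c j * (1 + t j • A).det := by
  classical
  set d := Module.finrank ℝ E
  set t : ℕ → ℝ := fun j => δ * ((j + 1) / (d + 1)) with ht
  have hinj : Set.InjOn t (Finset.range (d + 1) : Set ℕ) := by
    intro i _ j _ hij
    have h1 : ((i : ℝ) + 1) / (d + 1) = (j + 1) / (d + 1) := mul_left_cancel₀ hδ.ne' hij
    have h2 : ((d : ℝ) + 1) ≠ 0 := by positivity
    field_simp at h1
    exact_mod_cast (by linarith : (i : ℝ) = j)
  refine ⟨d + 1, t, fun j => (Lagrange.basis (Finset.range (d + 1)) t j).eval 1, ?_, ?_, ?_⟩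
  · intro j hj
    refine ⟨by positivity, ?_⟩
    have : ((j : ℝ) + 1) / (d + 1) ≤ 1 := by
      rw [div_le_one (by positivity)]
      exact_mod_cast hj
    calc t j ≤ δ * 1 := by simp only [ht]; gcongr
      _ = δ := mul_one _
  · rw [← Polynomial.eval_finsetSum, Lagrange.sum_basis hinj ⟨0, by simp⟩, Polynomial.eval_one]
  · intro A
    set b := Module.finBasis ℝ E
    set M := LinearMap.toMatrix b b (A : E →ₗ[ℝ] E)
    set p : Polynomial ℝ := Matrix.det ((Polynomial.X : Polynomial ℝ) • M.map Polynomial.C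
      + (1 : Matrix (Fin d) (Fin d) ℝ).map Polynomial.C) with hp
    have heval : ∀ s : ℝ, p.eval s = (1 + s • A).det := by
      intro s
      have : (1 + s • A).det = LinearMap.det ((1 : E →ₗ[ℝ] E) + s • (A : E →ₗ[ℝ] E)) := rfl
      rw [this, ← LinearMap.det_toMatrix b, hp, ← Polynomial.coe_evalRingHom, RingHom.map_det]
      congr 1
      ext i j
      by_cases hij : i = j <;>
        simp [M, LinearMap.toMatrix_one, Matrix.map_apply, hij, add_comm] <;> ring
    have hdeg : p.degree < (Finset.range (d + 1)).card := by
      rw [Finset.card_range]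
      refine lt_of_le_of_lt Polynomial.degree_le_natDegree ?_
      have := Polynomial.natDegree_det_X_add_C_le M 1
      rw [Fintype.card_fin] at this
      exact_mod_cast Nat.lt_succ_of_le this
    have h1 : p.eval 1 = _ := congrArg (Polynomial.eval 1) (Lagrange.eq_interpolate hinj hdeg)
    rw [heval, one_smul, Lagrange.interpolate_apply, Polynomial.eval_finsetSum] at h1
    rw [h1]
    refine Finset.sum_congr rfl fun j _ => ?_
    rw [Polynomial.eval_mul, Polynomial.eval_C, heval, mul_comm]

lemma det_one_add_pos {A : E →L[ℝ] E} (hA : ‖A‖ < 1) : 0 < (1 + A).det := by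
  have hne : ∀ s ∈ Icc (0 : ℝ) 1, (1 + s • A).det ≠ 0 := by
    intro s hs h0
    have hker := LinearMap.bot_lt_ker_of_det_eq_zero
      (f := ((1 + s • A : E →L[ℝ] E) : E →ₗ[ℝ] E)) h0
    obtain ⟨x, hx, hx0⟩ := (Submodule.ne_bot_iff _).1 hker.ne'
    have hx1 : x + s • A x = 0 := by simpa using hx
    have h2 : ‖x‖ = ‖s • A x‖ := by
      rw [← norm_neg (s • A x), ← eq_neg_of_add_eq_zero_left hx1]
    have h3 : ‖s • A x‖ ≤ 1 * (‖A‖ * ‖x‖) := by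
      rw [norm_smul, Real.norm_of_nonneg hs.1]
      exact mul_le_mul hs.2 (A.le_opNorm x) (norm_nonneg _) zero_le_one
    have h4 : 0 < ‖x‖ := norm_pos_iff.2 hx0
    nlinarith
  by_contra! hneg
  have hcont : ContinuousOn (fun s : ℝ => (1 + s • A).det) (Icc 0 1) :=
    (ContinuousLinearMap.continuous_det.comp (by fun_prop)).continuousOn
  have h01 : (0 : ℝ) ∈ Icc ((1 + (1 : ℝ) • A).det) ((1 + (0 : ℝ) • A).det) := by
    constructor
    · simpa using hneg
    · simp [ContinuousLinearMap.det]
  obtain ⟨s, hs, hs0⟩ := intermediate_value_Icc' zero_le_one hcont h01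
  exact hne s hs hs0

/-- For small `t` the map `x ↦ x + t (r x - x)` is a bijection of the open unit ball: it is a
perturbation of the identity with small Lipschitz constant. -/
lemma image_ball_of_small_homotopy {r : E → E} {K : NNReal} {t : ℝ} (ht : 0 < t) (ht1 : t < 1)
    (htK : t * K < 1) (hlip : LipschitzOnWith K (fun x => r x - x) (closedBall 0 1))
    (hball : ∀ x ∈ closedBall (0 : E) 1, ‖r x‖ ≤ 1)
    (hsph : ∀ x ∈ sphere (0 : E) 1, r x = x) :
    InjOn (fun x => x + t • (r x - x)) (ball 0 1) ∧
      (fun x => x + t • (r x - x)) '' ball 0 1 = ball 0 1 := by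
  set f : E → E := fun x => x + t • (r x - x) with hf
  have hfsph : ∀ x ∈ sphere (0 : E) 1, f x = x := by
    intro x hx
    simp [hf, hsph x hx]
  have happ : ApproximatesLinearOn f
      ((ContinuousLinearEquiv.refl ℝ E : E ≃L[ℝ] E) : E →L[ℝ] E) (ball 0 1)
      (t.toNNReal * K) := by
    intro x hx y hy
    have h1 := hlip.norm_sub_le (ball_subset_closedBall hx) (ball_subset_closedBall hy)
    have h2 : f x - f y - ((ContinuousLinearEquiv.refl ℝ E : E ≃L[ℝ] E) : E →L[ℝ] E) (x - y)
        = t • ((r x - x) - (r y - y)) := by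
      simp only [hf, ContinuousLinearEquiv.coe_refl, ContinuousLinearMap.coe_id', id]
      module
    rw [h2, norm_smul, Real.norm_of_nonneg ht.le, NNReal.coe_mul, Real.coe_toNNReal t ht.le,
      mul_assoc]
    exact mul_le_mul_of_nonneg_left h1 ht.le
  have hc : Subsingleton E ∨ (t.toNNReal * K : NNReal)
      < ‖((ContinuousLinearEquiv.refl ℝ E).symm : E →L[ℝ] E)‖₊⁻¹ := by
    rcases subsingleton_or_nontrivial E with h | h
    · exact Or.inl h
    · right
      have : ‖((ContinuousLinearEquiv.refl ℝ E).symm : E →L[ℝ] E)‖₊ = 1 := by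
        ext
        simp
      rw [this, inv_one, ← NNReal.coe_lt_coe]
      simpa [Real.coe_toNNReal t ht.le] using htK
  refine ⟨happ.injOn hc, ?_⟩
  have hopen : IsOpen (f '' ball 0 1) :=
    happ.open_image (ContinuousLinearEquiv.refl ℝ E).toNonlinearRightInverse isOpen_ball hc
  have hmaps : f '' ball 0 1 ⊆ ball 0 1 := by
    rintro _ ⟨x, hx, rfl⟩
    have h1 := hball x (ball_subset_closedBall hx)
    rw [mem_ball_zero_iff] at hx ⊢
    have h2 : f x = (1 - t) • x + t • r x := by simp only [hf]; module
    rw [h2]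
    calc ‖(1 - t) • x + t • r x‖ ≤ (1 - t) * ‖x‖ + t * ‖r x‖ := by
          refine (norm_add_le _ _).trans_eq ?_
          rw [norm_smul, norm_smul, Real.norm_of_nonneg ht.le,
            Real.norm_of_nonneg (by linarith)]
      _ < 1 := by nlinarith
  have hcont : ContinuousOn f (closedBall 0 1) := by
    have := hlip.continuousOn
    fun_prop
  have hclosed : IsClosed (f '' closedBall 0 1) :=
    ((isCompact_closedBall 0 1).image_of_continuousOn hcont).isClosed
  refine Subset.antisymm hmaps ?_
  -- the image is nonempty, open, and closed relative to the (connected) open ball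
  refine ((convex_ball (0 : E) 1).isPreconnected).subset_left_of_subset_union hopen
    hclosed.isOpen_compl ?_ ?_ ⟨f 0, hmaps ⟨0, by simp, rfl⟩, 0, by simp, rfl⟩
  · exact disjoint_compl_right_iff_subset.2 (image_mono ball_subset_closedBall)
  · intro y hy
    by_cases h : y ∈ f '' closedBall 0 1
    · left
      obtain ⟨x, hx, rfl⟩ := h
      refine ⟨x, ?_, rfl⟩
      rcases (mem_closedBall_zero_iff.1 hx).lt_or_eq with h1 | h1
      · simpa using h1
      · rw [hfsph x (by simpa using h1)] at hy
        exact hy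
    · exact Or.inr h

variable [MeasurableSpace E] [BorelSpace E]

/-- There is no `C¹` retraction of the closed unit ball onto its boundary sphere. The integral
over the ball of `det (1 + t (Dr - 1))` is polynomial in `t`, and equals the volume of the ball for
small `t > 0`; at `t = 1` it vanishes, because the range of `Dr` is orthogonal to `r`. -/
theorem no_contDiff_retraction {r : E → E}
    (hr : ∀ x ∈ closedBall (0 : E) 1, ContDiffAt ℝ 1 r x)
    (hnorm : ∀ x ∈ closedBall (0 : E) 1, ‖r x‖ = 1)
    (hsph : ∀ x ∈ sphere (0 : E) 1, r x = x) : False := by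
  have hh : ∀ x ∈ closedBall (0 : E) 1, ContDiffAt ℝ 1 (fun x => r x - x) x :=
    fun x hx => (hr x hx).sub contDiffAt_id
  obtain ⟨K, hK⟩ : ∃ K, LipschitzOnWith K (fun x => r x - x) (closedBall (0 : E) 1) := by
    refine LocallyLipschitzOn.exists_lipschitzOnWith_of_compact (isCompact_closedBall _ _) ?_
    intro x hx
    obtain ⟨K, t, ht, h⟩ := (hh x hx).exists_lipschitzOnWith
    exact ⟨K, t, mem_nhdsWithin_of_mem_nhds ht, h⟩
  set D : E → E →L[ℝ] E := fun x => fderiv ℝ (fun x => r x - x) x with hD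
  have hDnorm : ∀ x ∈ ball (0 : E) 1, ‖D x‖ ≤ K := fun x hx =>
    norm_fderiv_le_of_lipschitzOn ℝ (closedBall_mem_nhds_of_mem hx) hK
  have hDcont : ContinuousOn D (closedBall 0 1) := fun x hx =>
    ((hh x hx).continuousAt_fderiv one_ne_zero).continuousWithinAt
  have hDr : ∀ x ∈ closedBall (0 : E) 1, 1 + D x = fderiv ℝ r x := by
    intro x hx
    have : D x = fderiv ℝ r x - 1 :=
      (((hr x hx).differentiableAt one_ne_zero).hasFDerivAt.sub (hasFDerivAt_id x)).fderiv
    rw [this]; abel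
  have hK1 : (0 : ℝ) < 1 / (2 * (K + 1)) := by positivity
  obtain ⟨m, t, c, htj, hsum, hdet⟩ := exists_weights_det_one_add (E := E) hK1
  have hsmall : ∀ j < m, t j < 1 ∧ t j * K < 1 := by
    intro j hj
    obtain ⟨h1, h2⟩ := htj j hj
    have hK0 : (0 : ℝ) ≤ K := K.2
    rw [le_div_iff₀ (by positivity)] at h2
    constructor <;> nlinarith
  have hint : ∀ s : ℝ, IntegrableOn (fun x => (1 + s • D x).det) (ball (0 : E) 1) volume := by
    intro s
    refine IntegrableOn.mono_set ?_ ball_subset_closedBall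
    refine ContinuousOn.integrableOn_compact (isCompact_closedBall _ _) ?_
    exact ContinuousLinearMap.continuous_det.comp_continuousOn (by fun_prop)
  have hvol : ∀ j < m, ∫ x in ball (0 : E) 1, (1 + t j • D x).det
      = volume.real (ball (0 : E) 1) := by
    intro j hj
    obtain ⟨hinj, himg⟩ := image_ball_of_small_homotopy (htj j hj).1 (hsmall j hj).1
      (hsmall j hj).2 hK (fun x hx => (hnorm x hx).le) hsph
    have hder : ∀ x ∈ ball (0 : E) 1, HasFDerivWithinAt (fun x => x + t j • (r x - x))
        (1 + t j • D x) (ball 0 1) x := fun x hx =>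
      ((hasFDerivAt_id x).add ((((hh x (ball_subset_closedBall hx)).differentiableAt
        one_ne_zero).hasFDerivAt).const_smul (t j))).hasFDerivWithinAt
    have h1 := integral_image_eq_integral_abs_det_fderiv_smul volume measurableSet_ball hder hinj
      (fun _ => (1 : ℝ))
    rw [himg] at h1
    rw [setIntegral_const, smul_eq_mul, mul_one] at h1
    rw [h1]
    refine setIntegral_congr_fun measurableSet_ball fun x hx => ?_
    have : ‖t j • D x‖ < 1 := by
      rw [norm_smul, Real.norm_of_nonneg (htj j hj).1.le]
      exact (mul_le_mul_of_nonneg_left (hDnorm x hx) (htj j hj).1.le).trans_lt (hsmall j hj).2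
    simp only [smul_eq_mul, mul_one]
    rw [abs_of_pos (det_one_add_pos this)]
  have hzero : ∀ x ∈ ball (0 : E) 1, (1 + D x).det = 0 := by
    intro x hx
    have hx' := ball_subset_closedBall hx
    rw [hDr x hx']
    by_contra hne
    have hsurj : Function.Surjective (fderiv ℝ r x) := by
      have h := (LinearMap.isUnit_iff_isUnit_det (fderiv ℝ r x : E →ₗ[ℝ] E)).2
        (isUnit_iff_ne_zero.2 hne)
      exact ((Module.End.isUnit_iff _).1 h).surjective
    obtain ⟨v, hv⟩ := hsurj (r x)
    have hd := ((hr x hx').differentiableAt one_ne_zero).hasFDerivAt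
    have h1 := hd.norm_sq
    have h2 : HasFDerivAt (fun y => ‖r y‖ ^ 2) (0 : E →L[ℝ] ℝ) x := by
      refine (hasFDerivAt_const (1 : ℝ) x).congr_of_eventuallyEq ?_
      filter_upwards [isOpen_ball.mem_nhds hx] with y hy
      rw [hnorm y (ball_subset_closedBall hy), one_pow]
    have h3 := congrArg (fun T : E →L[ℝ] ℝ => T v) (h1.unique h2)
    have h4 : inner ℝ (r x) (r x) = (1 : ℝ) := by
      rw [real_inner_self_eq_norm_sq, hnorm x hx', one_pow]
    have h5 : r x = 0 := by simpa [hv] using h3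
    simp [h5] at h4
  have hfin : ∫ x in ball (0 : E) 1, (1 + D x).det = volume.real (ball (0 : E) 1) := by
    calc ∫ x in ball (0 : E) 1, (1 + D x).det
        = ∫ x in ball (0 : E) 1, ∑ j ∈ Finset.range m, c j * (1 + t j • D x).det :=
          setIntegral_congr_fun measurableSet_ball fun x _ => hdet (D x)
      _ = ∑ j ∈ Finset.range m, c j * ∫ x in ball (0 : E) 1, (1 + t j • D x).det := by
          rw [integral_finsetSum _ fun j _ => (hint (t j)).const_mul (c j)]
          simp_rw [integral_const_mul]
      _ = ∑ j ∈ Finset.range m, c j * volume.real (ball (0 : E) 1) :=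
          Finset.sum_congr rfl fun j hj => by rw [hvol j (Finset.mem_range.1 hj)]
      _ = volume.real (ball (0 : E) 1) := by rw [← Finset.sum_mul, hsum, one_mul]
  rw [setIntegral_congr_fun measurableSet_ball hzero, integral_zero] at hfin
  have hpos : 0 < volume.real (ball (0 : E) 1) :=
    ENNReal.toReal_pos (measure_ball_pos _ _ one_pos).ne' measure_ball_lt_top.ne
  exact hpos.ne hfin

/-- A continuous map into the ball of radius `1 / 2` has a fixed point. Otherwise a smooth
approximation `p` has no fixed point in the closed unit ball either, and following the ray from
`p x` through `x` up to the sphere gives a smooth retraction. -/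
lemma exists_fixedPoint_of_norm_le_half {G : E → E} (hG : Continuous G)
    (hb : ∀ x, ‖G x‖ ≤ 1 / 2) : ∃ x, G x = x := by
  by_contra! hne
  obtain ⟨x₀, -, hmin⟩ := (isCompact_closedBall (0 : E) 1).exists_isMinOn ⟨0, by simp⟩
    (f := fun x => ‖G x - x‖) (by fun_prop)
  have hδ : 0 < ‖G x₀ - x₀‖ := norm_pos_iff.2 (sub_ne_zero.2 (hne x₀))
  obtain ⟨p, hp, happ, -⟩ := hG.exists_contDiff_approx 1
    (ε := fun _ => min ‖G x₀ - x₀‖ (1 / 4)) continuous_const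
    (fun _ => lt_min hδ (by norm_num))
  have hp1 : ∀ x, ‖p x‖ < 1 := by
    intro x
    have h1 : ‖p x - G x‖ < 1 / 4 := by
      rw [← dist_eq_norm]
      exact (happ x).trans_le (min_le_right _ _)
    have h2 := norm_sub_norm_le (p x) (G x)
    linarith [hb x]
  have hpne : ∀ x ∈ closedBall (0 : E) 1, x - p x ≠ 0 := by
    intro x hx h0
    have h1 : ‖p x - G x‖ < ‖G x₀ - x₀‖ := by
      rw [← dist_eq_norm]
      exact (happ x).trans_le (min_le_left _ _)
    have h2 : ‖G x₀ - x₀‖ ≤ ‖G x - x‖ := hmin hx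
    rw [← sub_eq_zero.1 h0, norm_sub_rev] at h1
    linarith
  set b : E → ℝ := fun x => inner ℝ x (x - p x) with hbdef
  set disc : E → ℝ := fun x => b x ^ 2 + ‖x - p x‖ ^ 2 * (1 - ‖x‖ ^ 2) with hdisc
  set s : E → ℝ := fun x => (-b x + √(disc x)) / ‖x - p x‖ ^ 2 with hs
  have hbpos : ∀ x ∈ sphere (0 : E) 1, 0 < b x := by
    intro x hx
    have hx1 : ‖x‖ = 1 := by simpa using hx
    have h1 := real_inner_le_norm x (p x)
    simp only [hbdef, inner_sub_right, real_inner_self_eq_norm_sq, hx1]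
    rw [hx1] at h1
    linarith [hp1 x]
  have hdpos : ∀ x ∈ closedBall (0 : E) 1, 0 < disc x := by
    intro x hx
    have h3 : 0 < ‖x - p x‖ := norm_pos_iff.2 (hpne x hx)
    rcases (mem_closedBall_zero_iff.1 hx).lt_or_eq with h1 | h1
    · have : 0 < 1 - ‖x‖ ^ 2 := by nlinarith [norm_nonneg x]
      simp only [hdisc]
      positivity
    · have h2 := hbpos x (by simpa using h1)
      simp only [hdisc, h1]
      nlinarith
  refine no_contDiff_retraction (r := fun x => x + s x • (x - p x)) ?_ ?_ ?_
  · intro x hx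
    have hu : ContDiffAt ℝ 1 (fun x => x - p x) x := contDiffAt_id.sub hp.contDiffAt
    have hb1 : ContDiffAt ℝ 1 b x := contDiffAt_id.inner ℝ hu
    have hd1 : ContDiffAt ℝ 1 disc x :=
      (hb1.pow 2).add ((hu.norm_sq ℝ).mul (contDiffAt_const.sub (contDiffAt_id.norm_sq ℝ)))
    have hs1 : ContDiffAt ℝ 1 s x :=
      (hb1.neg.add (hd1.sqrt (hdpos x hx).ne')).div (hu.norm_sq ℝ)
        (pow_ne_zero 2 (norm_ne_zero_iff.2 (hpne x hx)))
    exact contDiffAt_id.add (hs1.smul hu)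
  · intro x hx
    have h0 : ‖x - p x‖ ^ 2 ≠ 0 := pow_ne_zero 2 (norm_ne_zero_iff.2 (hpne x hx))
    have hq : √(disc x) ^ 2 = disc x := Real.sq_sqrt (hdpos x hx).le
    have h1 : ‖x + s x • (x - p x)‖ ^ 2 = 1 := by
      rw [norm_add_sq_real, inner_smul_right, norm_smul, mul_pow, Real.norm_eq_abs, sq_abs]
      change ‖x‖ ^ 2 + 2 * (s x * b x) + s x ^ 2 * ‖x - p x‖ ^ 2 = 1
      have h2 : s x * ‖x - p x‖ ^ 2 = -b x + √(disc x) := div_mul_cancel₀ _ h0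
      have h3 : (‖x‖ ^ 2 + 2 * (s x * b x) + s x ^ 2 * ‖x - p x‖ ^ 2 - 1) * ‖x - p x‖ ^ 2 = 0 := by
        have : s x ^ 2 * ‖x - p x‖ ^ 2 * ‖x - p x‖ ^ 2 = (-b x + √(disc x)) ^ 2 := by
          rw [← h2]; ring
        have h4 : s x * b x * ‖x - p x‖ ^ 2 = (-b x + √(disc x)) * b x := by
          rw [← h2]; ring
        have h5 : disc x = b x ^ 2 + ‖x - p x‖ ^ 2 * (1 - ‖x‖ ^ 2) := rfl
        linear_combination this + 2 * h4 + hq + h5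
      rcases mul_eq_zero.1 h3 with h4 | h4
      · linarith
      · exact absurd h4 h0
    exact (pow_eq_one_iff_of_nonneg (norm_nonneg _) two_ne_zero).1 h1
  · intro x hx
    have hx1 : ‖x‖ = 1 := by simpa using hx
    have : s x = 0 := by
      simp only [hs, hdisc, hx1]
      simp [Real.sqrt_sq (hbpos x hx).le]
    simp [this]

/-- **Brouwer's fixed point theorem**, for a bounded continuous self-map of a Euclidean space. -/
theorem exists_fixedPoint_of_bounded {G : E → E} (hG : Continuous G) {R : ℝ} (hR : 0 < R)
    (hb : ∀ x, ‖G x‖ ≤ R) : ∃ x, G x = x := by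
  obtain ⟨x, hx⟩ := exists_fixedPoint_of_norm_le_half
    (G := fun x => (2 * R)⁻¹ • G ((2 * R) • x)) (by fun_prop) (by
      intro x
      rw [norm_smul, Real.norm_of_nonneg (by positivity), inv_mul_le_iff₀ (by positivity)]
      linarith [hb ((2 * R) • x)])
  refine ⟨(2 * R) • x, ?_⟩
  nth_rw 2 [← hx]
  rw [smul_smul, mul_inv_cancel₀ (by positivity), one_smul]

end Brouwer

/-! ### Closed covers of a simplex -/

/-- The simplex `{x ∈ ℝ₊^L | ∑ xᵢ = a}`. -/
def scaledSimplex (L : ℕ) (a : ℝ) : Set (Fin L → ℝ) := {x | x ∈ orthant L ∧ ∑ i, x i = a}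

/-- A continuous retraction of `ℝ^L` onto the simplex. The second summand keeps the
normalizing factor positive. -/
lemma exists_continuous_retraction_scaledSimplex {L : ℕ} (hL : 0 < L) {a : ℝ} (ha : 0 < a) :
    ∃ ρ : (Fin L → ℝ) → (Fin L → ℝ), Continuous ρ ∧ (∀ x, ρ x ∈ scaledSimplex L a) ∧
      ∀ x ∈ scaledSimplex L a, ρ x = x := by
  set y : (Fin L → ℝ) → Fin L → ℝ := fun x i => max (x i) 0 + max (a - ∑ k, max (x k) 0) 0 with hy
  have hy0 : ∀ x i, 0 ≤ y x i := fun x i => by simp only [hy]; positivity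
  have hsum : ∀ x, 0 < ∑ i, y x i := by
    intro x
    refine ha.trans_le ?_
    have h1 : (1 : ℝ) ≤ L := by exact_mod_cast hL
    have h2 : 0 ≤ max (a - ∑ k, max (x k) 0) 0 := le_max_right _ _
    have h3 : a - ∑ k, max (x k) 0 ≤ max (a - ∑ k, max (x k) 0) 0 := le_max_left _ _
    simp only [hy, Finset.sum_add_distrib, Finset.sum_const, Finset.card_univ, Fintype.card_fin,
      nsmul_eq_mul]
    nlinarith
  refine ⟨fun x i => a * y x i / ∑ k, y x k, ?_, ?_, ?_⟩
  · have hc : ∀ i, Continuous fun x => y x i := fun i => by simp only [hy]; fun_prop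
    refine continuous_pi fun i => ?_
    exact (continuous_const.mul (hc i)).div (continuous_finsetSum _ fun k _ => hc k)
      fun x => (hsum x).ne'
  · intro x
    refine ⟨fun i => div_nonneg (mul_nonneg ha.le (hy0 x i)) (hsum x).le, ?_⟩
    rw [← Finset.sum_div, ← Finset.mul_sum, mul_div_cancel_right₀ _ (hsum x).ne']
  · rintro x ⟨hx0, hxa⟩
    have h1 : y x = x := by
      funext i
      have h2 : ∀ k, max (x k) 0 = x k := fun k => max_eq_left (hx0 k)
      simp only [hy, h2, hxa, sub_self, max_self, add_zero]
    funext i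
    simp only [h1, hxa]
    field_simp

/-- The dual form of the Knaster–Kuratowski–Mazurkiewicz lemma: if closed sets `A i` cover the
simplex and `A i` contains the face `xᵢ = 0` opposite to the `i`-th vertex, then they have a
common point. With `dᵢ` the distance to `A i`, a fixed point of the map that moves mass towards
the coordinates where `dᵢ` is below average is such a point. -/
theorem exists_mem_all_of_closed_cover {L : ℕ} (hL : 0 < L) {a : ℝ} (ha : 0 < a)
    (A : Fin L → Set (Fin L → ℝ)) (hclosed : ∀ i, IsClosed (A i))
    (hcover : ∀ x ∈ scaledSimplex L a, ∃ i, x ∈ A i)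
    (hface : ∀ x ∈ scaledSimplex L a, ∀ i, x i = 0 → x ∈ A i) :
    ∃ x ∈ scaledSimplex L a, ∀ i, x ∈ A i := by
  classical
  have hvert : ∀ i, (Pi.single i a : Fin L → ℝ) ∈ scaledSimplex L a := by
    intro i
    refine ⟨fun j => ?_, by simp⟩
    by_cases h : j = i
    · subst h; simp [ha.le]
    · simp [h]
  have hne : ∀ i, (A i).Nonempty := by
    intro i
    by_cases h : ∃ j, j ≠ i
    · obtain ⟨j, hj⟩ := h
      exact ⟨_, hface _ (hvert j) i (by simp [hj.symm])⟩
    · push Not at h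
      obtain ⟨k, hk⟩ := hcover _ (hvert i)
      exact ⟨_, h k ▸ hk⟩
  obtain ⟨ρ, hρc, hρm, hρ⟩ := exists_continuous_retraction_scaledSimplex hL ha
  set d : (Fin L → ℝ) → Fin L → ℝ := fun x i => Metric.infDist x (A i) with hd
  have hdc : ∀ i, Continuous fun x => d x i := fun i => Metric.continuous_infDist_pt _
  have hd0 : ∀ x i, d x i = 0 ↔ x ∈ A i := fun x i =>
    ((hclosed i).mem_iff_infDist_zero (hne i)).symm
  have hdnn : ∀ x i, 0 ≤ d x i := fun x i => Metric.infDist_nonneg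
  set e : (Fin L → ℝ) → Fin L → ℝ := fun x i => max (∑ k, d x k - L * d x i) 0 with he
  have hec : ∀ i, Continuous fun x => e x i := fun i =>
    ((continuous_finsetSum _ fun k _ => hdc k).sub (continuous_const.mul (hdc i))).max
      continuous_const
  have henn : ∀ x i, 0 ≤ e x i := fun x i => le_max_right _ _
  have hesum : ∀ x, 0 ≤ ∑ k, e x k := fun x => Finset.sum_nonneg fun k _ => henn x k
  set G : (Fin L → ℝ) → Fin L → ℝ := fun x i => a * (ρ x i + e (ρ x) i) / (a + ∑ k, e (ρ x) k)
    with hG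
  have hGc : Continuous G := by
    refine continuous_pi fun i => ?_
    refine (continuous_const.mul (((continuous_apply i).comp hρc).add ((hec i).comp hρc))).div
      (continuous_const.add (continuous_finsetSum _ fun k _ => (hec k).comp hρc)) ?_
    intro x
    have := hesum (ρ x)
    change a + ∑ k, e (ρ x) k ≠ 0
    positivity
  have hGm : ∀ x, G x ∈ scaledSimplex L a := by
    intro x
    have h1 := hesum (ρ x)
    refine ⟨fun i => div_nonneg (mul_nonneg ha.le (add_nonneg ((hρm x).1 i) (henn _ i)))
      (by positivity), ?_⟩
    simp only [hG]
    rw [← Finset.sum_div, ← Finset.mul_sum, Finset.sum_add_distrib, (hρm x).2,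
      mul_div_cancel_right₀ _ (by positivity)]
  have hle : ∀ x ∈ scaledSimplex L a, ∀ i, x i ≤ a := fun x hx i => by
    rw [← hx.2]
    exact Finset.single_le_sum (fun k _ => hx.1 k) (Finset.mem_univ i)
  obtain ⟨z, hz⟩ := exists_fixedPoint_of_bounded (E := EuclideanSpace ℝ (Fin L))
    (G := fun x => WithLp.toLp 2 (G (WithLp.ofLp x))) (by fun_prop) (R := √(L * a ^ 2))
    (by positivity) (by
      intro x
      rw [EuclideanSpace.norm_eq]
      refine Real.sqrt_le_sqrt ?_
      calc ∑ i, ‖G (WithLp.ofLp x) i‖ ^ 2 ≤ ∑ _i : Fin L, a ^ 2 := by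
            refine Finset.sum_le_sum fun i _ => ?_
            rw [Real.norm_of_nonneg ((hGm _).1 i)]
            exact pow_le_pow_left₀ ((hGm _).1 i) (hle _ (hGm _) i) 2
        _ = L * a ^ 2 := by simp)
  set x : Fin L → ℝ := WithLp.ofLp z with hxdef
  have hx : G x = x := congrArg WithLp.ofLp hz
  have hxm : x ∈ scaledSimplex L a := hx ▸ hGm x
  refine ⟨x, hxm, ?_⟩
  have hfix : ∀ i, x i * ∑ k, e x k = a * e x i := by
    intro i
    have h1 : a * (ρ x i + e (ρ x) i) / (a + ∑ k, e (ρ x) k) = x i := congrFun hx i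
    have h2 := hesum x
    rw [hρ x hxm, div_eq_iff (by positivity)] at h1
    linarith
  have hmean : ∑ i, (∑ k, d x k - L * d x i) = 0 := by
    rw [Finset.sum_sub_distrib, ← Finset.mul_sum]
    simp
  rcases (hesum x).eq_or_lt with h0 | hpos
  · have h1 : ∀ i, ∑ k, d x k - L * d x i ≤ 0 := by
      intro i
      have := (Finset.sum_eq_zero_iff_of_nonneg fun k _ => henn x k).1 h0.symm i (Finset.mem_univ i)
      exact max_eq_right_iff.1 this
    have h2 : ∀ i, ∑ k, d x k - L * d x i = 0 := fun i =>
      (Finset.sum_eq_zero_iff_of_nonpos fun k _ => h1 k).1 hmean i (Finset.mem_univ i)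
    obtain ⟨k, hk⟩ := hcover x hxm
    have h3 : ∑ k, d x k = 0 := by
      have := h2 k
      rw [(hd0 x k).2 hk] at this
      linarith
    intro i
    exact (hd0 x i).1 ((Finset.sum_eq_zero_iff_of_nonneg fun k _ => hdnn x k).1 h3 i
      (Finset.mem_univ i))
  · exfalso
    have hepos : ∀ i, 0 < e x i := by
      intro i
      refine (henn x i).lt_of_ne fun h => ?_
      have h1 : x i = 0 := by
        have := hfix i
        rw [← h, mul_zero] at this
        exact (mul_eq_zero.1 this).resolve_right hpos.ne'
      have h2 : d x i = 0 := (hd0 x i).2 (hface x hxm i h1)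
      have h3 : ∑ k, d x k ≤ 0 := by
        have : ∑ k, d x k - L * d x i ≤ 0 := max_eq_right_iff.1 h.symm
        rwa [h2, mul_zero, sub_zero] at this
      have h4 : ∀ k, d x k = 0 := fun k =>
        (Finset.sum_eq_zero_iff_of_nonneg fun k _ => hdnn x k).1
          (le_antisymm h3 (Finset.sum_nonneg fun k _ => hdnn x k)) k (Finset.mem_univ k)
      simp [he, h4] at hpos
    have h5 : ∀ i, 0 < ∑ k, d x k - L * d x i := fun i => by
      have := hepos i
      simpa [he] using this
    have : 0 < ∑ i, (∑ k, d x k - L * d x i) :=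
      Finset.sum_pos (fun i _ => h5 i) ⟨⟨0, hL⟩, Finset.mem_univ _⟩
    exact this.ne' hmean

/-! ### The radial mean and the Laplacian of a radial function -/

section RadialMean

open MeasureTheory

/-- The weighted mean `∫₀¹ θ^(n-1) g(sθ) dθ`. In dimension `n` it is `s^(-n) ∫₀ˢ t^(n-1) g(t) dt`
for `s > 0`, so that `-s` times it is the derivative at `s` of the radial solution of `-Δw = g`;
this form needs no separate convention at `s = 0`. -/
noncomputable def radialMean (n : ℕ) (g : ℝ → ℝ) (s : ℝ) : ℝ :=
  ∫ θ in (0 : ℝ)..1, θ ^ (n - 1) * g (s * θ)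

variable {n : ℕ} {g : ℝ → ℝ}

lemma continuous_radialMean (hg : Continuous g) : Continuous (radialMean n g) :=
  intervalIntegral.continuous_parametric_intervalIntegral_of_continuous' (by fun_prop) 0 1

lemma pow_mul_radialMean (hn : 1 ≤ n) (s : ℝ) :
    s ^ n * radialMean n g s = ∫ t in (0 : ℝ)..s, t ^ (n - 1) * g t := by
  have h := intervalIntegral.smul_integral_comp_mul_left (a := 0) (b := 1)
    (fun t => t ^ (n - 1) * g t) s
  rw [mul_zero, mul_one] at h
  rw [← h, radialMean, smul_eq_mul, ← intervalIntegral.integral_const_mul,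
    ← intervalIntegral.integral_const_mul]
  congr 1
  funext θ
  obtain ⟨m, rfl⟩ : ∃ m, n = m + 1 := ⟨n - 1, by omega⟩
  rw [Nat.add_sub_cancel, mul_pow, pow_succ]
  ring

lemma radialMean_zero (hn : 1 ≤ n) : n * radialMean n g 0 = g 0 := by
  obtain ⟨m, rfl⟩ : ∃ m, n = m + 1 := ⟨n - 1, by omega⟩
  simp only [radialMean, zero_mul, intervalIntegral.integral_mul_const, Nat.add_sub_cancel,
    integral_pow]
  push_cast
  have : (m : ℝ) + 1 ≠ 0 := by positivity
  field_simp
  simp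

lemma radialMean_nonneg {s : ℝ} (hg : ∀ t, 0 ≤ g t) : 0 ≤ radialMean n g s :=
  intervalIntegral.integral_nonneg zero_le_one fun _ hθ =>
    mul_nonneg (pow_nonneg hθ.1 _) (hg _)

lemma abs_radialMean_le {C s : ℝ} (hs : 0 ≤ s) (hg : ∀ t ∈ Icc 0 s, |g t| ≤ C) :
    |radialMean n g s| ≤ C := by
  have h := intervalIntegral.norm_integral_le_of_norm_le_const (a := 0) (b := 1) (C := C)
    (f := fun θ => θ ^ (n - 1) * g (s * θ)) (by
      intro θ hθ
      rw [uIoc_of_le zero_le_one] at hθ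
      have h1 := hg _ ⟨mul_nonneg hs hθ.1.le, mul_le_of_le_one_right hs hθ.2⟩
      rw [norm_mul, Real.norm_eq_abs, Real.norm_eq_abs, abs_pow, abs_of_pos hθ.1]
      calc θ ^ (n - 1) * |g (s * θ)| ≤ 1 * |g (s * θ)| :=
            mul_le_mul_of_nonneg_right (pow_le_one₀ hθ.1.le hθ.2) (abs_nonneg _)
        _ ≤ C := by rwa [one_mul])
  simpa [radialMean] using h

lemma hasDerivAt_radialMean (hn : 1 ≤ n) (hg : Continuous g) {s : ℝ} (hs : 0 < s) :
    HasDerivAt (radialMean n g) ((g s - n * radialMean n g s) / s) s := by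
  have h1 : HasDerivAt (fun s => ∫ t in (0 : ℝ)..s, t ^ (n - 1) * g t) (s ^ (n - 1) * g s) s :=
    intervalIntegral.integral_hasDerivAt_right (Continuous.intervalIntegrable (by fun_prop) _ _)
      (Continuous.stronglyMeasurableAtFilter (by fun_prop) _ _)
      (Continuous.continuousAt (by fun_prop))
  have h2 := h1.div (hasDerivAt_pow n s) (pow_pos hs n).ne'
  have h3 : radialMean n g =ᶠ[𝓝 s]
      (fun s => ∫ t in (0 : ℝ)..s, t ^ (n - 1) * g t) / fun s => s ^ n := by
    filter_upwards [lt_mem_nhds hs] with t ht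
    rw [Pi.div_apply, ← pow_mul_radialMean hn, mul_div_cancel_left₀ _ (pow_pos ht n).ne']
  refine (h2.congr_of_eventuallyEq h3).congr_deriv ?_
  rw [← pow_mul_radialMean hn]
  obtain ⟨m, rfl⟩ : ∃ m, n = m + 1 := ⟨n - 1, by omega⟩
  rw [Nat.add_sub_cancel]
  have : s ≠ 0 := hs.ne'
  field_simp
  ring

/-- The gradient field of the radial function with profile `∫₀ʳ s radialMean n g s ds`. -/
lemma hasFDerivAt_radialMean_smul (hn : 1 ≤ n) (hg : Continuous g)
    (x : EuclideanSpace ℝ (Fin n)) :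
    HasFDerivAt (fun x : EuclideanSpace ℝ (Fin n) => radialMean n g ‖x‖ • x)
      (radialMean n g ‖x‖ • ContinuousLinearMap.id ℝ _ +
        ((g ‖x‖ - n * radialMean n g ‖x‖) / ‖x‖ ^ 2) • (innerSL ℝ x).smulRight x) x := by
  have hH := continuous_radialMean (n := n) hg
  by_cases hx : x = 0
  · subst hx
    rw [hasFDerivAt_iff_isLittleO_nhds_zero]
    simp only [norm_zero, smul_zero, zero_add, sub_zero, map_zero,
      ContinuousLinearMap.smulRight_zero, add_zero]
    have h1 : ∀ h : EuclideanSpace ℝ (Fin n), radialMean n g ‖h‖ • h -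
        (radialMean n g 0 • ContinuousLinearMap.id ℝ (EuclideanSpace ℝ (Fin n))) h
        = (radialMean n g ‖h‖ - radialMean n g 0) • h := by
      intro h
      simp [sub_smul]
    simp_rw [h1]
    have h2 : (fun h : EuclideanSpace ℝ (Fin n) => radialMean n g ‖h‖ - radialMean n g 0)
        =o[𝓝 0] fun _ => (1 : ℝ) := by
      rw [Asymptotics.isLittleO_one_iff]
      have : Continuous fun h : EuclideanSpace ℝ (Fin n) =>
          radialMean n g ‖h‖ - radialMean n g 0 := by fun_prop
      exact this.tendsto' 0 0 (by simp)
    simpa using h2.smul_isBigO (Asymptotics.isBigO_refl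
      (fun h : EuclideanSpace ℝ (Fin n) => h) (𝓝 0))
  · have hx0 : 0 < ‖x‖ := norm_pos_iff.2 hx
    have h1 : HasFDerivAt (fun y : EuclideanSpace ℝ (Fin n) => ‖y‖ ^ 2) (2 • innerSL ℝ x) x := by
      simpa using (hasFDerivAt_id x).norm_sq
    have h2 := (Real.hasDerivAt_sqrt (pow_pos hx0 2).ne').comp_hasFDerivAt x h1
    have h3 : ((fun q : ℝ => √q) ∘ fun y : EuclideanSpace ℝ (Fin n) => ‖y‖ ^ 2) = fun y => ‖y‖ := by
      funext y
      exact Real.sqrt_sq (norm_nonneg y)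
    rw [h3] at h2
    have h4 := (hasDerivAt_radialMean hn hg hx0).comp_hasFDerivAt x h2
    refine (h4.smul (hasFDerivAt_id x)).congr_fderiv ?_
    ext1 v
    simp [Real.sqrt_sq hx0.le, smul_smul]
    congr 1
    field_simp

lemma hasFDerivAt_radial_profile (hg : Continuous g) {w : ℝ → ℝ} {a : ℝ}
    (hw : ∀ r, 0 ≤ r → w r = a - ∫ s in (0 : ℝ)..r, s * radialMean n g s)
    (x : EuclideanSpace ℝ (Fin n)) :
    HasFDerivAt (fun x : EuclideanSpace ℝ (Fin n) => w ‖x‖)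
      (innerSL ℝ (-(radialMean n g ‖x‖ • x))) x := by
  have hH := continuous_radialMean (n := n) hg
  -- in the variable `q = r ^ 2` the profile is differentiable up to and beyond `q = 0`
  have hsub : (fun x : EuclideanSpace ℝ (Fin n) => w ‖x‖) =
      fun x => a - ∫ q in (0 : ℝ)..‖x‖ ^ 2, radialMean n g √q / 2 := by
    funext x
    rw [hw _ (norm_nonneg x)]
    have h := intervalIntegral.integral_comp_mul_deriv (a := 0) (b := ‖x‖)
      (f := fun s : ℝ => s ^ 2) (f' := fun s => 2 * s) (g := fun q => radialMean n g √q / 2)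
      (fun s _ => by simpa using hasDerivAt_pow 2 s) (by fun_prop) (by fun_prop)
    rw [zero_pow two_ne_zero] at h
    rw [← h]
    congr 1
    refine intervalIntegral.integral_congr fun s hs => ?_
    rw [uIcc_of_le (norm_nonneg x)] at hs
    simp only [Function.comp, Real.sqrt_sq hs.1]
    ring
  rw [hsub]
  have h1 : HasFDerivAt (fun y : EuclideanSpace ℝ (Fin n) => ‖y‖ ^ 2) (2 • innerSL ℝ x) x := by
    simpa using (hasFDerivAt_id x).norm_sq
  have h2 : HasDerivAt (fun p => ∫ q in (0 : ℝ)..p, radialMean n g √q / 2)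
      (radialMean n g √(‖x‖ ^ 2) / 2) (‖x‖ ^ 2) :=
    intervalIntegral.integral_hasDerivAt_right (Continuous.intervalIntegrable (by fun_prop) _ _)
      (Continuous.stronglyMeasurableAtFilter (by fun_prop) _ _)
      (Continuous.continuousAt (by fun_prop))
  refine ((h2.comp_hasFDerivAt x h1).const_sub a).congr_fderiv ?_
  ext1 v
  simp [Real.sqrt_sq (norm_nonneg x)]
  ring

lemma contDiff_radialMean_smul (hn : 1 ≤ n) (hg : Continuous g) :
    ContDiff ℝ 1 (fun x : EuclideanSpace ℝ (Fin n) => radialMean n g ‖x‖ • x) := by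
  have hH := continuous_radialMean (n := n) hg
  have hd := hasFDerivAt_radialMean_smul (n := n) hn hg
  rw [contDiff_one_iff_fderiv]
  refine ⟨fun x => (hd x).differentiableAt, ?_⟩
  have : fderiv ℝ (fun x : EuclideanSpace ℝ (Fin n) => radialMean n g ‖x‖ • x) = _ :=
    funext fun x => (hd x).fderiv
  rw [this]
  refine (by fun_prop : Continuous fun x : EuclideanSpace ℝ (Fin n) =>
    radialMean n g ‖x‖ • ContinuousLinearMap.id ℝ (EuclideanSpace ℝ (Fin n))).add ?_
  rw [continuous_iff_continuousAt]
  intro x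
  by_cases hx : x = 0
  · subst hx
    have hlim : Tendsto (fun x : EuclideanSpace ℝ (Fin n) =>
        |g ‖x‖ - n * radialMean n g ‖x‖|) (𝓝 0) (𝓝 0) := by
      refine Continuous.tendsto' (by fun_prop) 0 0 ?_
      simp [radialMean_zero hn]
    have h0 : Tendsto (fun x : EuclideanSpace ℝ (Fin n) =>
        ((g ‖x‖ - n * radialMean n g ‖x‖) / ‖x‖ ^ 2) • (innerSL ℝ x).smulRight x) (𝓝 0) (𝓝 0) := by
      refine squeeze_zero_norm (fun x => ?_) hlim
      rw [norm_smul, ContinuousLinearMap.norm_smulRight_apply, innerSL_apply_norm, norm_div,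
        Real.norm_eq_abs, norm_pow, norm_norm]
      by_cases hx : x = 0
      · simp [hx]
      · have : ‖x‖ ≠ 0 := norm_ne_zero_iff.2 hx
        apply le_of_eq
        field_simp
    simpa [ContinuousAt] using h0
  · have h1 : ContinuousAt (fun x : EuclideanSpace ℝ (Fin n) =>
        (g ‖x‖ - n * radialMean n g ‖x‖) / ‖x‖ ^ 2) x :=
      ContinuousAt.div (by fun_prop) (by fun_prop) (pow_ne_zero 2 (norm_ne_zero_iff.2 hx))
    have h2 : Continuous fun x : EuclideanSpace ℝ (Fin n) => (innerSL ℝ x).smulRight x :=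
      (ContinuousLinearMap.smulRightL ℝ (EuclideanSpace ℝ (Fin n))
        (EuclideanSpace ℝ (Fin n))).continuous₂.comp
        ((innerSL ℝ).continuous.prodMk continuous_id)
    exact h1.smul h2.continuousAt

/-- A radial function with profile `a - ∫₀ʳ s radialMean n g s ds` is of class `C²`, also at the
origin. -/
lemma contDiff_radial_profile (hn : 1 ≤ n) (hg : Continuous g) {w : ℝ → ℝ} {a : ℝ}
    (hw : ∀ r, 0 ≤ r → w r = a - ∫ s in (0 : ℝ)..r, s * radialMean n g s) :
    ContDiff ℝ 2 (fun x : EuclideanSpace ℝ (Fin n) => w ‖x‖) := by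
  have hd := hasFDerivAt_radial_profile (n := n) hg hw
  rw [show (2 : WithTop ℕ∞) = 1 + 1 from one_add_one_eq_two.symm, contDiff_succ_iff_fderiv]
  refine ⟨fun x => (hd x).differentiableAt, by simp, ?_⟩
  have : fderiv ℝ (fun x : EuclideanSpace ℝ (Fin n) => w ‖x‖) = _ :=
    funext fun x => (hd x).fderiv
  rw [this]
  exact (innerSL ℝ).contDiff.comp (contDiff_radialMean_smul hn hg).neg

/-- A radial function with profile `a - ∫₀ʳ s radialMean n g s ds` solves `-Δw = g(|x|)`. -/
lemma laplacian_radial_profile (hn : 1 ≤ n) (hg : Continuous g) {w : ℝ → ℝ} {a : ℝ}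
    (hw : ∀ r, 0 ≤ r → w r = a - ∫ s in (0 : ℝ)..r, s * radialMean n g s)
    (x : EuclideanSpace ℝ (Fin n)) :
    (Δ (fun x : EuclideanSpace ℝ (Fin n) => w ‖x‖)) x = -g ‖x‖ := by
  have hd := hasFDerivAt_radial_profile (n := n) hg hw
  have h1 : fderiv ℝ (fun x : EuclideanSpace ℝ (Fin n) => w ‖x‖) = _ :=
    funext fun x => (hd x).fderiv
  rw [InnerProductSpace.laplacian_eq_iteratedFDeriv_orthonormalBasis _
    (EuclideanSpace.basisFun (Fin n) ℝ)]
  have h2 := (innerSL (E := EuclideanSpace ℝ (Fin n)) ℝ).hasFDerivAt.comp x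
    (hasFDerivAt_radialMean_smul hn hg x).neg
  have h3 := h2.fderiv
  simp only [iteratedFDeriv_two_apply, h1]
  have h4 : ∀ i, fderiv ℝ (fun x : EuclideanSpace ℝ (Fin n) =>
      innerSL ℝ (-(radialMean n g ‖x‖ • x))) x (EuclideanSpace.basisFun (Fin n) ℝ i)
        (EuclideanSpace.basisFun (Fin n) ℝ i)
      = -(radialMean n g ‖x‖ + (g ‖x‖ - n * radialMean n g ‖x‖) / ‖x‖ ^ 2 * x i ^ 2) := by
    intro i
    refine (congrArg (fun T : EuclideanSpace ℝ (Fin n) →L[ℝ] EuclideanSpace ℝ (Fin n) →L[ℝ] ℝ =>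
      T (EuclideanSpace.basisFun (Fin n) ℝ i) (EuclideanSpace.basisFun (Fin n) ℝ i)) h3).trans ?_
    change inner ℝ (-(radialMean n g ‖x‖ • EuclideanSpace.basisFun (Fin n) ℝ i +
      ((g ‖x‖ - n * radialMean n g ‖x‖) / ‖x‖ ^ 2) •
        (inner ℝ x (EuclideanSpace.basisFun (Fin n) ℝ i) • x)))
      (EuclideanSpace.basisFun (Fin n) ℝ i) = _
    rw [inner_neg_left, inner_add_left, real_inner_smul_left, real_inner_smul_left,
      real_inner_smul_left, real_inner_self_eq_norm_sq, OrthonormalBasis.norm_eq_one]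
    simp only [EuclideanSpace.basisFun_apply, EuclideanSpace.inner_single_right, conj_trivial]
    ring
  simp only [Matrix.cons_val_zero, Matrix.cons_val_one, h4]
  rw [Finset.sum_neg_distrib, Finset.sum_add_distrib, ← Finset.mul_sum,
    ← EuclideanSpace.real_norm_sq_eq]
  simp only [Finset.sum_const, Finset.card_univ, Fintype.card_fin, nsmul_eq_mul]
  by_cases hx : x = 0
  · subst hx
    simp [radialMean_zero hn]
  · have : ‖x‖ ≠ 0 := norm_ne_zero_iff.2 hx
    field_simp
    ring

end RadialMean

/-! ### Radial solutions of the initial value problem -/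

section RadialSolution

open MeasureTheory

variable {n L : ℕ}

/-- The integral operator whose value `w = radialPotential n G v` solves `Δwᵢ = Gᵢ(v(|x|))` with
`w(0) = 0` among radial functions; it is extended by `0` to negative arguments. -/
noncomputable def radialPotential (n : ℕ) (G : (Fin L → ℝ) → (Fin L → ℝ)) (v : ℝ → (Fin L → ℝ))
    (r : ℝ) : Fin L → ℝ :=
  fun i => ∫ s in (0 : ℝ)..max r 0, s * radialMean n (fun t => G (v t) i) s

/-- `u` is the profile of a radial solution of `-Δuᵢ = Gᵢ(u)`, in integral form. Profiles are
functions on all of `ℝ`, constant on `(-∞, 0]`. -/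
def IsRadialSolution (n : ℕ) (G : (Fin L → ℝ) → (Fin L → ℝ)) (u : C(ℝ, Fin L → ℝ)) : Prop :=
  ∀ r, u r = u 0 - radialPotential n G u r

variable {G : (Fin L → ℝ) → (Fin L → ℝ)}

lemma continuous_component (hG : Continuous G) {v : ℝ → (Fin L → ℝ)} (hv : Continuous v)
    (i : Fin L) : Continuous fun t => G (v t) i :=
  (continuous_apply i).comp (hG.comp hv)

lemma continuous_mul_radialMean (hG : Continuous G) {v : ℝ → (Fin L → ℝ)} (hv : Continuous v)
    (i : Fin L) : Continuous fun s => s * radialMean n (fun t => G (v t) i) s :=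
  continuous_id.mul (continuous_radialMean (continuous_component hG hv i))

lemma radialPotential_of_nonpos {v : ℝ → (Fin L → ℝ)} {r : ℝ} (hr : r ≤ 0) :
    radialPotential n G v r = 0 := by
  funext i
  simp [radialPotential, max_eq_right hr]

lemma radialPotential_congr {v v' : ℝ → (Fin L → ℝ)} {r : ℝ}
    (h : ∀ t ∈ Icc 0 r, v t = v' t) : radialPotential n G v r = radialPotential n G v' r := by
  rcases le_total r 0 with hr | hr
  · rw [radialPotential_of_nonpos hr, radialPotential_of_nonpos hr]
  funext i
  simp only [radialPotential, max_eq_left hr]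
  refine intervalIntegral.integral_congr fun s hs => ?_
  rw [uIcc_of_le hr] at hs
  simp only [radialMean]
  congr 1
  refine intervalIntegral.integral_congr fun θ hθ => ?_
  rw [uIcc_of_le zero_le_one] at hθ
  rw [h (s * θ) ⟨mul_nonneg hs.1 hθ.1, (mul_le_of_le_one_right hs.1 hθ.2).trans hs.2⟩]

lemma continuous_radialPotential (hG : Continuous G) {v : ℝ → (Fin L → ℝ)} (hv : Continuous v) :
    Continuous (radialPotential n G v) := by
  refine continuous_pi fun i => ?_
  have h := continuous_mul_radialMean (n := n) hG hv i
  exact (intervalIntegral.continuous_primitive (fun a b => h.intervalIntegrable a b) 0).comp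
    (continuous_id.max continuous_const)

/-- The common modulus of continuity of all potentials, when `G` is bounded by `C`. -/
lemma norm_radialPotential_sub_le (hG : Continuous G) {C : ℝ} (hC : ∀ v, ‖G v‖ ≤ C)
    {v : ℝ → (Fin L → ℝ)} (hv : Continuous v) (r s : ℝ) :
    ‖radialPotential n G v r - radialPotential n G v s‖
      ≤ |C * max r 0 ^ 2 / 2 - C * max s 0 ^ 2 / 2| := by
  rw [pi_norm_le_iff_of_nonneg (abs_nonneg _)]
  intro i
  have h := continuous_mul_radialMean (n := n) hG hv i
  simp only [radialPotential, Pi.sub_apply]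
  rw [intervalIntegral.integral_interval_sub_left (h.intervalIntegrable _ _)
    (h.intervalIntegrable _ _)]
  have h1 := intervalIntegral.norm_integral_le_abs_of_norm_le (μ := volume) (a := max s 0)
    (b := max r 0)
    (f := fun s => s * radialMean n (fun t => G (v t) i) s) (g := fun s => C * s)
    (by
      filter_upwards [ae_restrict_mem measurableSet_uIoc] with t ht
      have ht0 : 0 ≤ t := by
        have := ht.1
        exact (le_min (le_max_right _ _) (le_max_right _ _)).trans this.le
      rw [norm_mul, Real.norm_of_nonneg ht0, mul_comm]
      refine mul_le_mul_of_nonneg_right (abs_radialMean_le ht0 fun t _ => ?_) ht0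
      exact (norm_le_pi_norm _ i).trans (hC _))
    (Continuous.intervalIntegrable (by fun_prop) _ _)
  refine h1.trans_eq ?_
  rw [intervalIntegral.integral_const_mul, integral_id]
  congr 1
  ring

lemma tendsto_radialMean {g : ℝ → ℝ} {gk : ℕ → ℝ → ℝ} {C : ℝ} (hgk : ∀ k, Continuous (gk k))
    (hC : ∀ k t, |gk k t| ≤ C) (hlim : ∀ t, 0 ≤ t → Tendsto (fun k => gk k t) atTop (𝓝 (g t)))
    {s : ℝ} (hs : 0 ≤ s) :
    Tendsto (fun k => radialMean n (gk k) s) atTop (𝓝 (radialMean n g s)) := by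
  refine intervalIntegral.tendsto_integral_filter_of_dominated_convergence (fun _ => C) ?_ ?_ ?_ ?_
  · exact Eventually.of_forall fun k => Continuous.aestronglyMeasurable (by fun_prop)
  · refine Eventually.of_forall fun k => Eventually.of_forall fun θ hθ => ?_
    rw [uIoc_of_le zero_le_one] at hθ
    rw [norm_mul, norm_pow, Real.norm_of_nonneg hθ.1.le]
    calc θ ^ (n - 1) * ‖gk k (s * θ)‖ ≤ 1 * ‖gk k (s * θ)‖ :=
          mul_le_mul_of_nonneg_right (pow_le_one₀ hθ.1.le hθ.2) (norm_nonneg _)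
      _ ≤ C := by rw [one_mul]; exact hC _ _
  · exact intervalIntegrable_const
  · refine Eventually.of_forall fun θ hθ => ?_
    rw [uIoc_of_le zero_le_one] at hθ
    exact (hlim _ (mul_nonneg hs hθ.1.le)).const_mul _

lemma tendsto_radialPotential (hG : Continuous G) {C : ℝ} (hC : ∀ v, ‖G v‖ ≤ C)
    {v : ℝ → (Fin L → ℝ)} {vk : ℕ → ℝ → (Fin L → ℝ)} (hvk : ∀ k, Continuous (vk k))
    (hlim : ∀ t, 0 ≤ t → Tendsto (fun k => vk k t) atTop (𝓝 (v t))) (r : ℝ) :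
    Tendsto (fun k => radialPotential n G (vk k) r) atTop (𝓝 (radialPotential n G v r)) := by
  rw [tendsto_pi_nhds]
  intro i
  have hCi : ∀ k t, |G (vk k t) i| ≤ C := fun k t => (norm_le_pi_norm (G (vk k t)) i).trans (hC _)
  refine intervalIntegral.tendsto_integral_filter_of_dominated_convergence (fun s => s * C)
    ?_ ?_ ?_ ?_
  · exact Eventually.of_forall fun k =>
      (continuous_mul_radialMean hG (hvk k) i).aestronglyMeasurable
  · refine Eventually.of_forall fun k => Eventually.of_forall fun s hs => ?_
    rw [uIoc_of_le (le_max_right _ _)] at hs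
    rw [norm_mul, Real.norm_of_nonneg hs.1.le]
    exact mul_le_mul_of_nonneg_left (abs_radialMean_le hs.1.le fun t _ => hCi k t) hs.1.le
  · exact Continuous.intervalIntegrable (by fun_prop) _ _
  · refine Eventually.of_forall fun s hs => ?_
    rw [uIoc_of_le (le_max_right _ _)] at hs
    refine (tendsto_radialMean (fun k => continuous_component hG (hvk k) i) hCi
      (fun t ht => ?_) hs.1.le).const_mul s
    exact ((continuous_apply i).tendsto _).comp ((hG.tendsto _).comp (hlim t ht))

/-! ### Compactness and existence -/

/-- A form of the Arzelà–Ascoli theorem: functions with a common modulus of continuity. -/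
lemma isCompact_setOf_modulus {ω : ℝ → ℝ} (hω : Continuous ω) (a : ℝ) :
    IsCompact {u : C(ℝ, Fin L → ℝ) | ‖u 0‖ ≤ a ∧ ∀ r s, ‖u r - u s‖ ≤ |ω r - ω s|} := by
  have hωlim : ∀ r, Tendsto (fun s => |ω r - ω s|) (𝓝 r) (𝓝 0) := fun r =>
    Continuous.tendsto' (by fun_prop) r 0 (by simp)
  refine ArzelaAscoli.isCompact_of_equicontinuous _ ?_ ?_
  · have himg : ContinuousMap.toFun '' {u : C(ℝ, Fin L → ℝ) | ‖u 0‖ ≤ a ∧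
        ∀ r s, ‖u r - u s‖ ≤ |ω r - ω s|}
        = {f : ℝ → (Fin L → ℝ) | ‖f 0‖ ≤ a ∧ ∀ r s, ‖f r - f s‖ ≤ |ω r - ω s|} := by
      ext f
      constructor
      · rintro ⟨u, hu, rfl⟩
        exact hu
      · intro hf
        refine ⟨⟨f, continuous_iff_continuousAt.2 fun r => ?_⟩, hf, rfl⟩
        rw [ContinuousAt, tendsto_iff_norm_sub_tendsto_zero]
        exact squeeze_zero (fun _ => norm_nonneg _) (fun s => by
          rw [norm_sub_rev]; exact hf.2 r s) (hωlim r)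
    rw [himg]
    refine (isCompact_univ_pi fun r => isCompact_closedBall (0 : Fin L → ℝ)
      (a + |ω r - ω 0|)).of_isClosed_subset ?_ ?_
    · simp only [ofPred_and, ofPred_forall]
      refine (isClosed_le (by fun_prop) continuous_const).inter ?_
      exact isClosed_iInter fun r => isClosed_iInter fun s =>
        isClosed_le (by fun_prop) continuous_const
    · rintro f ⟨h0, hf⟩ r -
      rw [mem_closedBall_zero_iff]
      calc ‖f r‖ = ‖f 0 + (f r - f 0)‖ := by rw [add_sub_cancel]
        _ ≤ ‖f 0‖ + ‖f r - f 0‖ := norm_add_le _ _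
        _ ≤ a + |ω r - ω 0| := add_le_add h0 (hf r 0)
  · intro r
    rw [Metric.equicontinuousAt_iff]
    intro ε hε
    obtain ⟨δ, hδ, h⟩ := Metric.tendsto_nhds_nhds.1 (hωlim r) ε hε
    refine ⟨δ, hδ, fun s hs u => ?_⟩
    rw [dist_eq_norm]
    refine (u.2.2 r s).trans_lt ?_
    have := h hs
    rwa [Real.dist_eq, sub_zero, abs_abs] at this

/-- Functions `u k = α k - radialPotential n G (v k)` with bounded `α k` have a convergent
subsequence. -/
lemma exists_subseq_tendsto (hG : Continuous G) {C : ℝ} (hC : ∀ v, ‖G v‖ ≤ C) {a : ℝ}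
    {u : ℕ → C(ℝ, Fin L → ℝ)} {v : ℕ → ℝ → (Fin L → ℝ)} (hv : ∀ k, Continuous (v k))
    (hu0 : ∀ k, ‖u k 0‖ ≤ a) (hu : ∀ k r, u k r = u k 0 - radialPotential n G (v k) r) :
    ∃ (w : C(ℝ, Fin L → ℝ)) (φ : ℕ → ℕ), StrictMono φ ∧ Tendsto (u ∘ φ) atTop (𝓝 w) := by
  have hω : Continuous fun r : ℝ => C * max r 0 ^ 2 / 2 := by fun_prop
  obtain ⟨w, -, φ, hφ, hlim⟩ := (isCompact_setOf_modulus (L := L) hω a).tendsto_subseq (x := u)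
    (fun k => ⟨hu0 k, fun r s => by
      rw [hu k r, hu k s, sub_sub_sub_cancel_left, norm_sub_rev]
      exact norm_radialPotential_sub_le hG hC (hv k) r s⟩)
  exact ⟨w, φ, hφ, hlim⟩

lemma tendsto_apply_of_tendsto {u : ℕ → C(ℝ, Fin L → ℝ)} {w : C(ℝ, Fin L → ℝ)}
    (h : Tendsto u atTop (𝓝 w)) {t : ℕ → ℝ} {τ : ℝ} (ht : Tendsto t atTop (𝓝 τ)) :
    Tendsto (fun k => u k (t k)) atTop (𝓝 (w τ)) :=
  (ContinuousEval.continuous_eval.tendsto (w, τ)).comp (h.prodMk_nhds ht)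

/-- A sequence of radial solutions with bounded initial values has a subsequence that converges,
locally uniformly, to a radial solution. -/
theorem IsRadialSolution.exists_subseq (hG : Continuous G) {C : ℝ} (hC : ∀ v, ‖G v‖ ≤ C) {a : ℝ}
    {u : ℕ → C(ℝ, Fin L → ℝ)} (hu : ∀ k, IsRadialSolution n G (u k)) (hu0 : ∀ k, ‖u k 0‖ ≤ a) :
    ∃ (w : C(ℝ, Fin L → ℝ)) (φ : ℕ → ℕ), IsRadialSolution n G w ∧ StrictMono φ ∧
      Tendsto (u ∘ φ) atTop (𝓝 w) := by
  obtain ⟨w, φ, hφ, hlim⟩ := exists_subseq_tendsto hG hC (fun k => (u k).continuous) hu0 hu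
  refine ⟨w, φ, fun r => ?_, hφ, hlim⟩
  have hpt : ∀ r, Tendsto (fun k => u (φ k) r) atTop (𝓝 (w r)) := fun r =>
    tendsto_apply_of_tendsto hlim tendsto_const_nhds
  refine tendsto_nhds_unique (hpt r) ?_
  have h := (hpt 0).sub (tendsto_radialPotential (n := n) hG hC
    (fun k => (u (φ k)).continuous) (fun t _ => hpt t) r)
  exact h.congr fun k => (hu (φ k) r).symm

/-- Picard iterates for the equation with the delay `h`. They become stationary on bounded
intervals: see `delayedIterate_succ_eq`. -/
noncomputable def delayedIterate (n : ℕ) (G : (Fin L → ℝ) → (Fin L → ℝ)) (α : Fin L → ℝ) (h : ℝ) :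
    ℕ → ℝ → (Fin L → ℝ)
  | 0 => fun _ => α
  | m + 1 => fun r => α - radialPotential n G (fun t => delayedIterate n G α h m (t - h)) r

lemma continuous_delayedIterate (hG : Continuous G) (α : Fin L → ℝ) (h : ℝ) (m : ℕ) :
    Continuous (delayedIterate n G α h m) := by
  induction m with
  | zero => exact continuous_const
  | succ m ih => exact continuous_const.sub (continuous_radialPotential hG
      (ih.comp (continuous_id.sub continuous_const)))

lemma delayedIterate_succ_eq (α : Fin L → ℝ) (h : ℝ) (m : ℕ) :
    ∀ r ≤ m * h, delayedIterate n G α h (m + 1) r = delayedIterate n G α h m r := by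
  induction m with
  | zero =>
    intro r hr
    simp only [Nat.cast_zero, zero_mul] at hr
    simp [delayedIterate, radialPotential_of_nonpos hr]
  | succ m ih =>
    intro r hr
    simp only [delayedIterate] at ih ⊢
    congr 1
    refine radialPotential_congr fun t ht => ih _ ?_
    push_cast at hr
    linarith [ht.2]

/-- Existence of a radial solution with any given value at the origin, for bounded continuous
`G`, by Tonelli's method of delays. -/
theorem exists_isRadialSolution (hG : Continuous G) {C : ℝ} (hC : ∀ v, ‖G v‖ ≤ C)
    (α : Fin L → ℝ) : ∃ u : C(ℝ, Fin L → ℝ), IsRadialSolution n G u ∧ u 0 = α := by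
  set h : ℕ → ℝ := fun k => 1 / ((k : ℝ) + 1) with hh
  have hhlim : Tendsto h atTop (𝓝 0) := tendsto_one_div_add_atTop_nhds_zero_nat
  have hhpos : ∀ k, 0 < h k := fun k => by simp only [hh]; positivity
  set m : ℕ → ℕ := fun k => (k + 1) ^ 2 with hm
  have hmh : ∀ k, m k * h k = k + 1 := fun k => by
    simp only [hm, hh]
    push_cast
    field_simp
  set v : ℕ → ℝ → (Fin L → ℝ) := fun k t => delayedIterate n G α (h k) (m k) (t - h k)
  have hvc : ∀ k, Continuous (v k) := fun k =>
    (continuous_delayedIterate hG α (h k) (m k)).comp (continuous_id.sub continuous_const)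
  set u : ℕ → C(ℝ, Fin L → ℝ) := fun k =>
    ⟨delayedIterate n G α (h k) (m k + 1), continuous_delayedIterate hG α (h k) _⟩
  have hu' : ∀ k r, u k r = α - radialPotential n G (v k) r := fun k r => rfl
  have hu0 : ∀ k, u k 0 = α := fun k => by
    rw [hu', radialPotential_of_nonpos le_rfl, sub_zero]
  have hu : ∀ k r, u k r = u k 0 - radialPotential n G (v k) r := fun k r => by rw [hu0, hu']
  have hvu : ∀ (k : ℕ) (t : ℝ), t ≤ k + 1 → v k t = u k (t - h k) := by
    intro k t ht
    refine (delayedIterate_succ_eq α (h k) (m k) _ ?_).symm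
    rw [hmh]
    linarith [hhpos k]
  obtain ⟨w, φ, hφ, hlim⟩ := exists_subseq_tendsto (a := ‖α‖) hG hC hvc
    (fun k => by rw [hu0]) hu
  have hpt : ∀ r, Tendsto (fun k => u (φ k) r) atTop (𝓝 (w r)) := fun r =>
    tendsto_apply_of_tendsto hlim tendsto_const_nhds
  have hw0 : w 0 = α := tendsto_nhds_unique (hpt 0) (by simp [hu0])
  refine ⟨w, fun r => ?_, hw0⟩
  refine tendsto_nhds_unique (hpt r) ?_
  have hvlim : ∀ t, 0 ≤ t → Tendsto (fun k => v (φ k) t) atTop (𝓝 (w t)) := by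
    intro t _
    have h1 : Tendsto (fun k => t - h (φ k)) atTop (𝓝 t) := by
      simpa using tendsto_const_nhds.sub (hhlim.comp hφ.tendsto_atTop)
    refine (tendsto_apply_of_tendsto hlim h1).congr' ?_
    filter_upwards [eventually_ge_atTop ⌈t⌉₊] with k hk
    have h2 : t ≤ φ k + 1 := by
      have h3 : (⌈t⌉₊ : ℝ) ≤ φ k := by exact_mod_cast hk.trans (hφ.id_le k)
      linarith [Nat.le_ceil t]
    exact (hvu (φ k) t h2).symm
  have h2 := tendsto_const_nhds (x := w 0) |>.sub (tendsto_radialPotential (n := n) hG hC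
    (fun k => hvc (φ k)) hvlim r)
  refine h2.congr fun k => ?_
  rw [hu', hw0]

/-! ### Monotonicity and uniqueness -/

section Properties

variable {u v : C(ℝ, Fin L → ℝ)}

lemma IsRadialSolution.apply (hu : IsRadialSolution n G u) {r : ℝ} (hr : 0 ≤ r) (i : Fin L) :
    u r i = u 0 i - ∫ s in (0 : ℝ)..r, s * radialMean n (fun t => G (u t) i) s := by
  rw [hu r]
  simp [radialPotential, max_eq_left hr]

lemma IsRadialSolution.sub_apply (hG : Continuous G) (hu : IsRadialSolution n G u) {r s : ℝ}
    (hr : 0 ≤ r) (hs : 0 ≤ s) (i : Fin L) :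
    u r i - u s i = -∫ t in s..r, t * radialMean n (fun t => G (u t) i) t := by
  have h := continuous_mul_radialMean (n := n) hG u.continuous i
  rw [hu.apply hr, hu.apply hs, ← intervalIntegral.integral_interval_sub_left
    (h.intervalIntegrable 0 r) (h.intervalIntegrable 0 s)]
  ring

lemma IsRadialSolution.hasDerivAt (hG : Continuous G) (hu : IsRadialSolution n G u) {r : ℝ}
    (hr : 0 < r) (i : Fin L) :
    HasDerivAt (fun r => u r i) (-(r * radialMean n (fun t => G (u t) i) r)) r := by
  have h := continuous_mul_radialMean (n := n) hG u.continuous i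
  have h1 := (intervalIntegral.integral_hasDerivAt_right (h.intervalIntegrable 0 r)
    (h.stronglyMeasurableAtFilter _ _) h.continuousAt).const_sub (u 0 i)
  refine h1.congr_of_eventuallyEq ?_
  filter_upwards [lt_mem_nhds hr] with t ht
  exact hu.apply ht.le i

lemma IsRadialSolution.antitone (hG : Continuous G) (hG0 : ∀ v, G v ∈ orthant L)
    (hu : IsRadialSolution n G u) (i : Fin L) : AntitoneOn (fun r => u r i) (Ici 0) := by
  intro s hs r hr hsr
  have h := hu.sub_apply hG hr hs i
  have h1 : 0 ≤ ∫ t in s..r, t * radialMean n (fun t => G (u t) i) t :=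
    intervalIntegral.integral_nonneg hsr fun t ht =>
      mul_nonneg (le_trans hs ht.1) (radialMean_nonneg fun t => hG0 _ i)
  change u r i ≤ u s i
  linarith

/-- If a component takes the same value at two radii, then its source vanishes up to there: the
derivative of the component at a radius involves the source on the whole ball. -/
lemma IsRadialSolution.source_eq_zero (hn : 1 ≤ n) (hG : Continuous G)
    (hG0 : ∀ v, G v ∈ orthant L) (hu : IsRadialSolution n G u) {s r : ℝ} (hs : 0 ≤ s)
    (hsr : s < r) {i : Fin L} (h : u s i = u r i) : G (u s) i = 0 := by
  set m := (s + r) / 2 with hm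
  have hsm : s < m := by linarith
  have hmr : m < r := by linarith
  have hm0 : 0 < m := hs.trans_lt hsm
  have hconst : ∀ t ∈ Ioo s r, u t i = u s i := by
    intro t ht
    have h1 := hu.antitone hG hG0 i hs (hs.trans ht.1.le) ht.1.le
    have h2 := hu.antitone hG hG0 i (hs.trans ht.1.le : (0 : ℝ) ≤ t) (hs.trans hsr.le) ht.2.le
    exact le_antisymm h1 (h ▸ h2)
  have hd : HasDerivAt (fun r => u r i) 0 m := by
    refine (hasDerivAt_const m (u s i)).congr_of_eventuallyEq ?_
    filter_upwards [Ioo_mem_nhds hsm hmr] with t ht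
    exact hconst t ht
  have h1 := (hu.hasDerivAt hG hm0 i).unique hd
  have h2 : radialMean n (fun t => G (u t) i) m = 0 := by
    rcases mul_eq_zero.1 (neg_eq_zero.1 h1) with h | h
    · exact absurd h hm0.ne'
    · exact h
  by_contra hne
  have hc := continuous_component hG u.continuous i
  have hpos : 0 < ∫ t in (0 : ℝ)..m, t ^ (n - 1) * G (u t) i := by
    -- nonzero at `s`, hence nonzero just to the right of `s`
    obtain ⟨c, hc0, hc1⟩ : ∃ c, c ∈ Ioo s m ∧ G (u c) i ≠ 0 := by
      have h3 : ∀ᶠ t in 𝓝[>] s, G (u t) i ≠ 0 :=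
        (hc.continuousAt.eventually_ne hne).filter_mono nhdsWithin_le_nhds
      obtain ⟨c, h4, h5⟩ := (h3.and (Ioo_mem_nhdsGT hsm)).exists
      exact ⟨c, h5, h4⟩
    refine intervalIntegral.integral_pos hm0 (by fun_prop)
      (fun t ht => mul_nonneg (pow_nonneg ht.1.le _) (hG0 _ i))
      ⟨c, ⟨hs.trans hc0.1.le, hc0.2.le⟩, ?_⟩
    exact mul_pos (pow_pos (hs.trans_lt hc0.1) _) ((hG0 _ i).lt_of_ne hc1.symm)
  rw [← pow_mul_radialMean hn, h2, mul_zero] at hpos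
  exact hpos.ne rfl

lemma abs_radialMean_sub_le {g₁ g₂ : ℝ → ℝ} (h₁ : Continuous g₁) (h₂ : Continuous g₂) {C s : ℝ}
    (hs : 0 ≤ s) (h : ∀ t ∈ Icc 0 s, |g₁ t - g₂ t| ≤ C) :
    |radialMean n g₁ s - radialMean n g₂ s| ≤ C := by
  have h1 : radialMean n g₁ s - radialMean n g₂ s = radialMean n (fun t => g₁ t - g₂ t) s := by
    simp only [radialMean]
    rw [← intervalIntegral.integral_sub (Continuous.intervalIntegrable (by fun_prop) _ _)
      (Continuous.intervalIntegrable (by fun_prop) _ _)]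
    simp only [mul_sub]
  rw [h1]
  exact abs_radialMean_le hs h

/-- Uniqueness for as long as one of the two solutions stays where `G` is locally Lipschitz. -/
theorem IsRadialSolution.eqOn (hG : Continuous G) (hu : IsRadialSolution n G u)
    (hv : IsRadialSolution n G v) (h0 : u 0 = v 0) {τ : ℝ}
    (hlip : ∀ r ∈ Ico 0 τ, ∃ K, ∃ U ∈ 𝓝 (u r), LipschitzOnWith K G U) :
    ∀ r ∈ Icc 0 τ, u r = v r := by
  set S : Set ℝ := {r | ∀ t ∈ Ici (0 : ℝ), u (min t r) = v (min t r)} with hS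
  have hSclosed : IsClosed S := by
    simp only [hS, ofPred_forall]
    exact isClosed_biInter fun t _ => isClosed_eq (by fun_prop) (by fun_prop)
  suffices h : Icc 0 τ ⊆ S by
    intro r hr
    have := h hr r hr.1
    rwa [min_self] at this
  refine (hSclosed.inter isClosed_Icc).Icc_subset_of_forall_exists_gt ?_ ?_
  · intro t ht
    rw [min_eq_right ht]
    exact h0
  rintro x ⟨hxS, hx⟩ y hy
  have hxu : ∀ t ∈ Icc 0 x, u t = v t := fun t ht => by
    have := hxS t ht.1
    rwa [min_eq_left ht.2] at this
  obtain ⟨K, U, hU, hK⟩ := hlip x hx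
  have hUu : ∀ᶠ t in 𝓝 x, u t ∈ U := u.continuous.continuousAt hU
  have hUv : ∀ᶠ t in 𝓝 x, v t ∈ U := by
    rw [hxu x ⟨hx.1, le_rfl⟩] at hU
    exact v.continuous.continuousAt hU
  obtain ⟨δ₁, hδ₁, hball⟩ := Metric.eventually_nhds_iff.1 (hUu.and hUv)
  have hK0 : (0 : ℝ) ≤ K := K.2
  have hx1 : (0 : ℝ) < x + 1 := by linarith [hx.1]
  set δ := min (min (δ₁ / 2) (y - x)) (min 1 (1 / (2 * ((x + 1) * K + 1)))) with hδ
  have hδpos : 0 < δ := by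
    have : 0 < y - x := sub_pos.2 hy
    simp only [hδ]
    positivity
  have hδ1 : δ ≤ δ₁ / 2 := (min_le_left _ _).trans (min_le_left _ _)
  have hδ2 : δ ≤ y - x := (min_le_left _ _).trans (min_le_right _ _)
  have hδ3 : δ ≤ 1 := (min_le_right _ _).trans (min_le_left _ _)
  have hδ4 : δ * ((x + 1) * K) < 1 := by
    have h1 : δ ≤ 1 / (2 * ((x + 1) * K + 1)) := (min_le_right _ _).trans (min_le_right _ _)
    rw [le_div_iff₀ (by positivity)] at h1
    nlinarith [mul_nonneg hx1.le hK0]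
  obtain ⟨m, hm, hmax⟩ := (isCompact_Icc (a := 0) (b := x + δ)).exists_isMaxOn
    ⟨0, le_rfl, by linarith [hx.1]⟩ (f := fun t => ‖u t - v t‖) (by fun_prop)
  set D := ‖u m - v m‖ with hD
  have hG1 : ∀ i, ∀ t ∈ Icc 0 (x + δ), |G (u t) i - G (v t) i| ≤ K * D := by
    intro i t ht
    rcases le_total t x with h | h
    · rw [hxu t ⟨ht.1, h⟩, sub_self, abs_zero]
      positivity
    · have h1 : dist t x < δ₁ := by
        rw [Real.dist_eq, abs_of_nonneg (by linarith)]
        linarith [ht.2]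
      have h2 := hball h1
      calc |G (u t) i - G (v t) i| ≤ ‖G (u t) - G (v t)‖ := norm_le_pi_norm (G (u t) - G (v t)) i
        _ ≤ K * ‖u t - v t‖ := hK.norm_sub_le h2.1 h2.2
        _ ≤ K * D := mul_le_mul_of_nonneg_left (hmax ht) hK0
  have hbound : ∀ r ∈ Icc x (x + δ), ‖u r - v r‖ ≤ δ * ((x + 1) * K) * D := by
    intro r hr
    rw [pi_norm_le_iff_of_nonneg (by positivity)]
    intro i
    have hr0 : 0 ≤ r := hx.1.trans hr.1
    have h1 := hu.sub_apply hG hr0 hx.1 i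
    have h2 := hv.sub_apply hG hr0 hx.1 i
    have hcu := continuous_mul_radialMean (n := n) hG u.continuous i
    have hcv := continuous_mul_radialMean (n := n) hG v.continuous i
    have h3 : (u r - v r) i = -∫ t in x..r, (t * radialMean n (fun t => G (u t) i) t
        - t * radialMean n (fun t => G (v t) i) t) := by
      rw [intervalIntegral.integral_sub (hcu.intervalIntegrable _ _)
        (hcv.intervalIntegrable _ _), Pi.sub_apply]
      have := congrFun (hxu x ⟨hx.1, le_rfl⟩) i
      linarith
    rw [h3, norm_neg]
    have h4 := intervalIntegral.norm_integral_le_of_norm_le_const (a := x) (b := r)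
      (C := (x + 1) * (K * D)) (f := fun t => t * radialMean n (fun t => G (u t) i) t
        - t * radialMean n (fun t => G (v t) i) t) (by
      intro t ht
      rw [uIoc_of_le hr.1] at ht
      have ht0 : 0 ≤ t := hx.1.trans ht.1.le
      rw [← mul_sub, norm_mul, Real.norm_of_nonneg ht0]
      refine mul_le_mul (by linarith [ht.2, hr.2]) ?_ (norm_nonneg _) hx1.le
      exact abs_radialMean_sub_le (continuous_component hG u.continuous i)
        (continuous_component hG v.continuous i) ht0
        fun s hs => hG1 i s ⟨hs.1, hs.2.trans (ht.2.trans hr.2)⟩)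
    refine h4.trans ?_
    rw [abs_of_nonneg (sub_nonneg.2 hr.1)]
    have h5 : r - x ≤ δ := by linarith [hr.2]
    calc (x + 1) * (K * D) * (r - x) ≤ (x + 1) * (K * D) * δ :=
          mul_le_mul_of_nonneg_left h5 (by positivity)
      _ = δ * ((x + 1) * K) * D := by ring
  have hD0 : D = 0 := by
    rcases le_total m x with h | h
    · rw [hD, hxu m ⟨hm.1, h⟩, sub_self, norm_zero]
    · have h1 := hbound m ⟨h, hm.2⟩
      have h2 : 0 ≤ D := norm_nonneg _
      nlinarith
  refine ⟨x + δ, fun t ht => ?_, by linarith, by linarith⟩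
  have hmem : min t (x + δ) ∈ Icc 0 (x + δ) :=
    ⟨le_min ht (by linarith [hx.1]), min_le_right _ _⟩
  have := hmax hmem
  simp only [mem_ofPred_eq, ← hD, hD0] at this
  exact sub_eq_zero.1 (norm_le_zero_iff.1 this)

end Properties

end RadialSolution

/-! ### Truncation of the nonlinearity -/

/-- The projection of `ℝ^L` onto the box `[0, a]^L`. -/
def boxProj (L : ℕ) (a : ℝ) (v : Fin L → ℝ) : Fin L → ℝ := fun i => max 0 (min (v i) a)

section Truncation

variable {L : ℕ} {a : ℝ}

lemma lipschitzWith_boxProj (a : ℝ) : LipschitzWith 1 (boxProj L a) := by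
  refine LipschitzWith.of_dist_le_mul fun v w => ?_
  refine (dist_pi_le_iff (by positivity)).2 fun i => ?_
  refine (((LipschitzWith.id.min_const a).const_max 0).dist_le_mul (v i) (w i)).trans ?_
  exact mul_le_mul_of_nonneg_left (dist_le_pi_dist v w i) (by positivity)

lemma boxProj_eq_self {v : Fin L → ℝ} (hv : v ∈ orthant L) (hva : ∀ i, v i ≤ a) :
    boxProj L a v = v := by
  funext i
  simp [boxProj, min_eq_left (hva i), max_eq_right (hv i)]

lemma boxProj_mem_orthant (v : Fin L → ℝ) : boxProj L a v ∈ orthant L := fun _ => le_max_left _ _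

lemma isClosed_orthant : IsClosed (orthant L) := by
  simp only [orthant, ofPred_forall]
  exact isClosed_iInter fun i => isClosed_le continuous_const (continuous_apply i)

variable {F : (Fin L → ℝ) → (Fin L → ℝ)}

lemma continuous_comp_boxProj (hF : ContinuousOn F (orthant L)) :
    Continuous (F ∘ boxProj L a) :=
  hF.comp_continuous (lipschitzWith_boxProj a).continuous boxProj_mem_orthant

lemma exists_norm_comp_boxProj_le (hF : ContinuousOn F (orthant L)) (ha : 0 ≤ a) :
    ∃ C, ∀ v, ‖(F ∘ boxProj L a) v‖ ≤ C := by
  obtain ⟨C, hC⟩ := (isCompact_Icc (a := (0 : Fin L → ℝ))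
    (b := fun _ => a)).exists_bound_of_continuousOn (hF.mono fun v hv i => hv.1 i)
  exact ⟨C, fun v => hC _ ⟨fun i => le_max_left _ _, fun i => max_le ha (min_le_right _ _)⟩⟩

lemma exists_lipschitzOnWith_comp_boxProj (hF : LocallyLipschitzOn (interior (orthant L)) F)
    {v : Fin L → ℝ} (hv : ∀ i, 0 < v i) (hva : ∀ i, v i ≤ a) :
    ∃ K, ∃ U ∈ 𝓝 v, LipschitzOnWith K (F ∘ boxProj L a) U := by
  have hmem : v ∈ interior (orthant L) := by
    refine mem_interior.2 ⟨{v | ∀ i, 0 < v i}, fun v hv i => (hv i).le, ?_, hv⟩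
    simp only [ofPred_forall]
    exact isOpen_iInter_of_finite fun i => isOpen_lt continuous_const (continuous_apply i)
  obtain ⟨K, t, ht, hK⟩ := hF hmem
  rw [isOpen_interior.nhdsWithin_eq hmem] at ht
  refine ⟨K * 1, boxProj L a ⁻¹' t, ?_, hK.comp (lipschitzWith_boxProj a).lipschitzOnWith
    (mapsTo_preimage _ _)⟩
  refine (lipschitzWith_boxProj a).continuous.continuousAt ?_
  rwa [boxProj_eq_self (fun i => (hv i).le) hva]

/-- Non-degeneracy without permutations: where some but not all components vanish, one of the
vanishing components has a positive source. -/
lemma NonDegenerate.exists_pos (hF : NonDegenerate F) {v : Fin L → ℝ} (hv : v ∈ orthant L)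
    (h0 : ∃ i, v i = 0) (h1 : ∃ i, v i ≠ 0) : ∃ i, v i = 0 ∧ 0 < F v i := by
  classical
  -- sort the indices so that the positive components come first
  set f : Fin L → ℕ := fun i => if v i = 0 then 1 else 0 with hf
  set σ := Tuple.sort f with hσ
  have hmono : Monotone (f ∘ σ) := Tuple.monotone_sort f
  have hex : ∃ k : ℕ, ∃ hk : k < L, v (σ ⟨k, hk⟩) = 0 := by
    obtain ⟨i, hi⟩ := h0
    exact ⟨σ.symm i, (σ.symm i).2, by simpa using hi⟩
  set k := Nat.find hex with hk
  obtain ⟨hkL, hvk⟩ := Nat.find_spec hex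
  have hlt : ∀ j : Fin L, (j : ℕ) < k → v (σ j) ≠ 0 := fun j hj h =>
    Nat.find_min hex hj ⟨j.2, h⟩
  have hge : ∀ j : Fin L, k ≤ (j : ℕ) → v (σ j) = 0 := by
    intro j hj
    by_contra hne
    have h2 : f (σ ⟨k, hkL⟩) ≤ f (σ j) := hmono (Fin.le_def.2 hj)
    simp only [hf] at h2
    rw [if_neg hne, if_pos hvk] at h2
    omega
  have hk1 : 1 ≤ k := by
    obtain ⟨i, hi⟩ := h1
    by_contra hlt1
    refine hi ?_
    have := hge (σ.symm i) (by omega)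
    simpa using this
  have hpos := hF σ k hk1 hkL v hv (fun j hj => (hv _).lt_of_ne (hlt j hj).symm) hge
  by_contra! hcon
  refine absurd hpos (not_lt.2 (Finset.sum_nonpos fun j hj => ?_))
  exact hcon _ (hge j (by simpa using hj))

end Truncation

/-! ### Nonnegative solutions starting in the simplex -/

section Shooting

variable {n L : ℕ} {F : (Fin L → ℝ) → (Fin L → ℝ)} {a : ℝ} {u v : C(ℝ, Fin L → ℝ)}

lemma le_of_mem_scaledSimplex {α : Fin L → ℝ} (hα : α ∈ scaledSimplex L a) (i : Fin L) :
    α i ≤ a := by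
  rw [← hα.2]
  exact Finset.single_le_sum (fun k _ => hα.1 k) (Finset.mem_univ i)

/-- `u` solves the initial value problem with the source truncated to the box `[0, a]^L`, and
starts in the simplex of size `a`. Since its components decrease, the truncation has no effect as
long as `u` stays in the orthant. -/
structure IsShot (n : ℕ) (F : (Fin L → ℝ) → (Fin L → ℝ)) (a : ℝ) (u : C(ℝ, Fin L → ℝ)) :
    Prop where
  sol : IsRadialSolution n (F ∘ boxProj L a) u
  init : u 0 ∈ scaledSimplex L a

namespace IsShot

lemma antitone (hu : IsShot n F a u) (hFm : MapsTo F (orthant L) (orthant L))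
    (hFc : ContinuousOn F (orthant L)) (i : Fin L) : AntitoneOn (fun r => u r i) (Ici 0) :=
  hu.sol.antitone (continuous_comp_boxProj hFc) (fun _ => hFm (boxProj_mem_orthant _)) i

lemma le (hu : IsShot n F a u) (hFm : MapsTo F (orthant L) (orthant L))
    (hFc : ContinuousOn F (orthant L)) {r : ℝ} (hr : 0 ≤ r) (i : Fin L) : u r i ≤ a :=
  (hu.antitone hFm hFc i self_mem_Ici hr hr).trans (le_of_mem_scaledSimplex hu.init i)

lemma mem_orthant_of_le (hu : IsShot n F a u) (hFm : MapsTo F (orthant L) (orthant L))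
    (hFc : ContinuousOn F (orthant L)) {r s : ℝ} (hr : 0 ≤ r) (hrs : r ≤ s)
    (hs : u s ∈ orthant L) : u r ∈ orthant L := fun i =>
  (hs i).trans (hu.antitone hFm hFc i hr (hr.trans hrs : (0 : ℝ) ≤ s) hrs)

lemma source_eq (hu : IsShot n F a u) (hFm : MapsTo F (orthant L) (orthant L))
    (hFc : ContinuousOn F (orthant L)) {r : ℝ} (hr : 0 ≤ r) (h : u r ∈ orthant L) :
    (F ∘ boxProj L a) (u r) = F (u r) := by
  rw [Function.comp_apply, boxProj_eq_self h (hu.le hFm hFc hr)]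

/-- Non-degeneracy forbids that some but not all components vanish before the solution leaves the
orthant: a vanishing component would have to vanish from there on, hence have no source. -/
lemma pos_or_eq_zero (hn : 1 ≤ n) (hu : IsShot n F a u) (hFm : MapsTo F (orthant L) (orthant L))
    (hFc : ContinuousOn F (orthant L)) (hFn : NonDegenerate F) {r τ : ℝ} (hr : 0 ≤ r) (hrτ : r < τ)
    (hτ : u τ ∈ orthant L) : (∀ i, 0 < u r i) ∨ u r = 0 := by
  by_contra! hcon
  obtain ⟨⟨i, hi⟩, hne⟩ := hcon
  have hmem := hu.mem_orthant_of_le hFm hFc hr hrτ.le hτ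
  obtain ⟨k, hk⟩ := Function.ne_iff.1 hne
  obtain ⟨j, hj0, hj⟩ := hFn.exists_pos hmem ⟨i, le_antisymm hi (hmem i)⟩ ⟨k, hk⟩
  have h1 : u τ j ≤ u r j := hu.antitone hFm hFc j hr (hr.trans hrτ.le : (0 : ℝ) ≤ τ) hrτ.le
  have h2 : u r j = u τ j := le_antisymm (hj0 ▸ hτ j) h1
  have h3 := hu.sol.source_eq_zero hn (continuous_comp_boxProj hFc)
    (fun _ => hFm (boxProj_mem_orthant _)) hr hrτ h2
  rw [hu.source_eq hFm hFc hr hmem] at h3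
  exact hj.ne' h3

lemma contDiff_radial (hn : 1 ≤ n) (hu : IsShot n F a u) (hFc : ContinuousOn F (orthant L)) :
    ContDiff ℝ 2 (radial n u) :=
  contDiff_pi.2 fun i => contDiff_radial_profile hn
    (continuous_component (continuous_comp_boxProj (a := a) hFc) u.continuous i)
    fun _ hr => hu.sol.apply hr i

lemma neg_laplacian_radial (hn : 1 ≤ n) (hu : IsShot n F a u)
    (hFm : MapsTo F (orthant L) (orthant L)) (hFc : ContinuousOn F (orthant L))
    (x : EuclideanSpace ℝ (Fin n)) (hx : u ‖x‖ ∈ orthant L) (i : Fin L) :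
    -(Δ (fun y => radial n u y i)) x = F (radial n u x) i := by
  have h := laplacian_radial_profile hn
    (continuous_component (continuous_comp_boxProj (a := a) hFc) u.continuous i)
    (fun _ hr => hu.sol.apply hr i) x
  rw [hu.source_eq hFm hFc (norm_nonneg x) hx] at h
  change -(Δ (fun y : EuclideanSpace ℝ (Fin n) => u ‖y‖ i)) x = F (u ‖x‖) i
  rw [h, neg_neg]

lemma init_ne_zero (hu : IsShot n F a u) (ha : 0 < a) : u 0 ≠ 0 := by
  intro h
  have := hu.init.2
  simp only [h, Pi.zero_apply, Finset.sum_const_zero] at this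
  exact ha.ne this

/-- If all components vanish simultaneously at some point, then up to the first such point `u`
solves the Dirichlet problem. -/
lemma exists_isDirichletSolution (hn : 1 ≤ n) (ha : 0 < a) (hu : IsShot n F a u)
    (hFm : MapsTo F (orthant L) (orthant L)) (hFc : ContinuousOn F (orthant L))
    (hFn : NonDegenerate F) {r : ℝ} (hr : 0 ≤ r) (hr0 : u r = 0) :
    ∃ R : ℝ, 0 < R ∧ ∃ w : ℝ → (Fin L → ℝ), IsDirichletSolution F R (radial n w) := by
  have hcomp : IsCompact (Icc 0 r ∩ {s | u s = 0}) :=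
    isCompact_Icc.inter_right (isClosed_eq u.continuous continuous_const)
  obtain ⟨R, ⟨hR, hR0⟩, hmin⟩ := hcomp.exists_isLeast ⟨r, ⟨hr, le_rfl⟩, hr0⟩
  have hRpos : 0 < R := hR.1.lt_of_ne fun h => hu.init_ne_zero ha (h ▸ hR0)
  have hRmem : u R ∈ orthant L := by
    have : u R = 0 := hR0
    rw [this]
    exact fun i => le_rfl
  have hpos : ∀ s, 0 ≤ s → s < R → ∀ i, 0 < u s i := by
    intro s hs hsR
    refine (hu.pos_or_eq_zero hn hFm hFc hFn hs hsR hRmem).resolve_right fun h => ?_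
    exact not_le.2 hsR (hmin ⟨⟨hs, hsR.le.trans hR.2⟩, h⟩)
  have hcd := hu.contDiff_radial hn hFc
  refine ⟨R, hRpos, u, hcd.contDiffOn, hcd.continuous.continuousOn, fun x hx i => ?_,
    fun x hx i => ?_, fun x hx i => ?_⟩
  · rw [mem_ball_zero_iff] at hx
    exact hu.neg_laplacian_radial hn hFm hFc x
      (fun i => (hpos _ (norm_nonneg x) hx i).le) i
  · rw [mem_ball_zero_iff] at hx
    exact hpos _ (norm_nonneg x) hx i
  · rw [mem_sphere_zero_iff_norm] at hx
    have : u R = 0 := hR0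
    simp [radial, hx, this]

lemma pos_of_lt (h_no : ¬ ∃ R : ℝ, 0 < R ∧ ∃ w : ℝ → (Fin L → ℝ),
      IsDirichletSolution F R (radial n w)) (hn : 1 ≤ n) (ha : 0 < a) (hu : IsShot n F a u)
    (hFm : MapsTo F (orthant L) (orthant L)) (hFc : ContinuousOn F (orthant L))
    (hFn : NonDegenerate F) {r τ : ℝ} (hr : 0 ≤ r) (hrτ : r < τ) (hτ : u τ ∈ orthant L)
    (i : Fin L) : 0 < u r i :=
  (hu.pos_or_eq_zero hn hFm hFc hFn hr hrτ hτ).resolve_right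
    (fun h => h_no (hu.exists_isDirichletSolution hn ha hFm hFc hFn hr h)) i

lemma isEntireSolution (h_no : ¬ ∃ R : ℝ, 0 < R ∧ ∃ w : ℝ → (Fin L → ℝ),
      IsDirichletSolution F R (radial n w)) (hn : 1 ≤ n) (ha : 0 < a) (hu : IsShot n F a u)
    (hFm : MapsTo F (orthant L) (orthant L)) (hFc : ContinuousOn F (orthant L))
    (hFn : NonDegenerate F) (hmem : ∀ r, 0 ≤ r → u r ∈ orthant L) :
    IsEntireSolution F (radial n u) where
  contDiff := hu.contDiff_radial hn hFc
  eqn x i := hu.neg_laplacian_radial hn hFm hFc x (hmem _ (norm_nonneg x)) i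
  pos x i := hu.pos_of_lt h_no hn ha hFm hFc hFn (norm_nonneg x) (lt_add_one _)
    (hmem _ (by positivity)) i

/-- A solution that leaves the orthant does so through a point of its boundary. -/
lemma exists_exit (hu : IsShot n F a u) {r : ℝ} (hr : 0 ≤ r) (hru : u r ∉ orthant L) :
    ∃ τ, 0 ≤ τ ∧ u τ ∈ orthant L ∧ ∃ i, u τ i = 0 := by
  have hcomp : IsCompact (Icc 0 r ∩ {s | u s ∈ orthant L}) :=
    isCompact_Icc.inter_right (isClosed_orthant.preimage u.continuous)
  obtain ⟨τ, ⟨hτ, hτmem⟩, hmax⟩ := hcomp.exists_isGreatest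
    ⟨0, ⟨le_rfl, hr⟩, hu.init.1⟩
  refine ⟨τ, hτ.1, hτmem, ?_⟩
  by_contra! hne
  have hτr : τ < r := hτ.2.lt_of_ne fun h => hru (h ▸ hτmem)
  have hpos : ∀ i, ∀ᶠ t in 𝓝 τ, 0 < u t i := fun i =>
    ((continuous_apply i).comp u.continuous).continuousAt.eventually
      (lt_mem_nhds ((hτmem i).lt_of_ne (hne i).symm))
  obtain ⟨t, ht, htr⟩ := (((eventually_all.2 hpos).filter_mono nhdsWithin_le_nhds).and
    (Ioo_mem_nhdsGT hτr)).exists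
  exact not_le.2 htr.1 (hmax ⟨⟨hτ.1.trans htr.1.le, htr.2.le⟩, fun i => (ht i).le⟩)

/-- Without radial solutions of the Dirichlet problem, uniqueness holds for as long as one of the
two solutions stays in the orthant: before that radius it is in the interior, where `F` is locally
Lipschitz. -/
lemma eq_of_mem_orthant (h_no : ¬ ∃ R : ℝ, 0 < R ∧ ∃ w : ℝ → (Fin L → ℝ),
      IsDirichletSolution F R (radial n w)) (hn : 1 ≤ n) (ha : 0 < a) (hu : IsShot n F a u)
    (hv : IsShot n F a v) (huv : u 0 = v 0)
    (hFm : MapsTo F (orthant L) (orthant L)) (hFc : ContinuousOn F (orthant L))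
    (hFl : LocallyLipschitzOn (interior (orthant L)) F) (hFn : NonDegenerate F) {σ : ℝ}
    (hσ : 0 ≤ σ) (hσu : u σ ∈ orthant L) : u σ = v σ := by
  refine hu.sol.eqOn (continuous_comp_boxProj hFc) hv.sol huv (τ := σ) (fun r hr => ?_) σ
    ⟨hσ, le_rfl⟩
  exact exists_lipschitzOnWith_comp_boxProj hFl
    (hu.pos_of_lt h_no hn ha hFm hFc hFn hr.1 hr.2 hσu) (hu.le hFm hFc hr.1)

end IsShot

/-! ### The shooting argument -/

/-- The initial values from which some solution, staying in the orthant, reaches the face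
`vᵢ = 0`. The radius `0` is allowed, so that this set contains the points of the simplex on that
face. -/
def exitSet (n : ℕ) (F : (Fin L → ℝ) → (Fin L → ℝ)) (a : ℝ) (i : Fin L) : Set (Fin L → ℝ) :=
  {α | ∃ u, IsShot n F a u ∧ u 0 = α ∧ ∃ τ, 0 ≤ τ ∧ u τ ∈ orthant L ∧ u τ i = 0}

/-- If no solution stays in the orthant forever, then the exit sets are closed: the exit radii
along a convergent sequence of solutions stay bounded. -/
lemma isClosed_exitSet (ha : 0 ≤ a) (hFm : MapsTo F (orthant L) (orthant L))
    (hFc : ContinuousOn F (orthant L))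
    (hnone : ∀ u, IsShot n F a u → ∃ r, 0 ≤ r ∧ u r ∉ orthant L) (i : Fin L) :
    IsClosed (exitSet n F a i) := by
  refine IsSeqClosed.isClosed fun α β hα hlim => ?_
  choose u hu hu0 τ hτ hτmem hτi using hα
  obtain ⟨C, hC⟩ := exists_norm_comp_boxProj_le hFc ha
  have hbdd : ∀ k, ‖u k 0‖ ≤ a := fun k => by
    refine (pi_norm_le_iff_of_nonneg ha).2 fun j => ?_
    rw [Real.norm_of_nonneg ((hu k).init.1 j)]
    exact le_of_mem_scaledSimplex (hu k).init j
  obtain ⟨w, φ, hw, hφ, hlimw⟩ := IsRadialSolution.exists_subseq (continuous_comp_boxProj hFc) hC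
    (fun k => (hu k).sol) hbdd
  have hpt : ∀ r, Tendsto (fun k => u (φ k) r) atTop (𝓝 (w r)) := fun r =>
    tendsto_apply_of_tendsto hlimw tendsto_const_nhds
  have hw0 : w 0 = β := tendsto_nhds_unique (hpt 0) (by
    simp_rw [hu0]
    exact hlim.comp hφ.tendsto_atTop)
  have hclosed : IsClosed (scaledSimplex L a) :=
    isClosed_orthant.inter (isClosed_eq (by fun_prop) continuous_const)
  have hshot : IsShot n F a w :=
    ⟨hw, hclosed.mem_of_tendsto (hpt 0) (Eventually.of_forall fun k => (hu (φ k)).init)⟩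
  obtain ⟨r, hr, hrw⟩ := hnone w hshot
  have hfreq : ∃ᶠ k in atTop, τ (φ k) ∈ Icc 0 r := by
    intro hev
    refine hrw (isClosed_orthant.mem_of_tendsto (hpt r) ?_)
    filter_upwards [hev] with k hk
    have h1 : r < τ (φ k) := by
      by_contra! h
      exact hk ⟨hτ _, h⟩
    exact (hu (φ k)).mem_orthant_of_le hFm hFc hr h1.le (hτmem _)
  obtain ⟨τ', hτ', ψ, hψ, hlimτ⟩ := isCompact_Icc.tendsto_subseq' hfreq
  have h2 := tendsto_apply_of_tendsto (hlimw.comp hψ.tendsto_atTop) hlimτ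
  refine ⟨w, hshot, hw0, τ', hτ'.1,
    isClosed_orthant.mem_of_tendsto h2 (Eventually.of_forall fun k => hτmem _), ?_⟩
  refine tendsto_nhds_unique (((continuous_apply i).tendsto _).comp h2) ?_
  refine tendsto_const_nhds.congr fun k => ?_
  exact (hτi (φ (ψ k))).symm

lemma pos_of_forall_not_isDirichletSolution (h_no : ¬ ∃ R : ℝ, 0 < R ∧ ∃ w : ℝ → (Fin L → ℝ),
    IsDirichletSolution F R (radial n w)) : 0 < L := by
  rcases Nat.eq_zero_or_pos L with rfl | h
  · refine absurd ⟨1, one_pos, fun _ => 0, ?_⟩ h_no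
    exact ⟨contDiff_const.contDiffOn, continuousOn_const, fun _ _ i => i.elim0,
      fun _ _ i => i.elim0, fun _ _ i => i.elim0⟩
  · exact h

/-- In every simplex there is an initial value of a solution that stays in the orthant. -/
theorem exists_isShot_forall_mem_orthant (hn : 1 ≤ n) (ha : 0 < a)
    (hFm : MapsTo F (orthant L) (orthant L)) (hFc : ContinuousOn F (orthant L))
    (hFl : LocallyLipschitzOn (interior (orthant L)) F) (hFn : NonDegenerate F)
    (h_no : ¬ ∃ R : ℝ, 0 < R ∧ ∃ w : ℝ → (Fin L → ℝ), IsDirichletSolution F R (radial n w)) :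
    ∃ u, IsShot n F a u ∧ ∀ r, 0 ≤ r → u r ∈ orthant L := by
  by_contra! hnone
  have hL := pos_of_forall_not_isDirichletSolution h_no
  have hex : ∀ α ∈ scaledSimplex L a, ∃ u, IsShot n F a u ∧ u 0 = α := by
    intro α hα
    obtain ⟨C, hC⟩ := exists_norm_comp_boxProj_le hFc ha.le
    obtain ⟨u, hu, hu0⟩ := exists_isRadialSolution (n := n) (continuous_comp_boxProj hFc) hC α
    exact ⟨u, ⟨hu, hu0 ▸ hα⟩, hu0⟩
  obtain ⟨α, -, hα⟩ := exists_mem_all_of_closed_cover hL ha (exitSet n F a)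
    (isClosed_exitSet ha.le hFm hFc hnone) (by
      intro α hα
      obtain ⟨u, hu, hu0⟩ := hex α hα
      obtain ⟨r, hr, hru⟩ := hnone u hu
      obtain ⟨τ, hτ, hτmem, i, hi⟩ := hu.exists_exit hr hru
      exact ⟨i, u, hu, hu0, τ, hτ, hτmem, hi⟩) (by
      intro α hα i hi
      obtain ⟨u, hu, hu0⟩ := hex α hα
      exact ⟨u, hu, hu0, 0, le_rfl, hu0 ▸ hα.1, by rw [hu0, hi]⟩)
  choose u hu hu0 τ hτ hτmem hτi using hα
  have : Nonempty (Fin L) := ⟨⟨0, hL⟩⟩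
  obtain ⟨k, hk⟩ := Finite.exists_min τ
  -- the solution that exits first does so through all faces at once
  have hzero : u k (τ k) = 0 := by
    funext j
    have heq : u k (τ k) = u j (τ k) := (hu k).eq_of_mem_orthant h_no hn ha (hu j)
      ((hu0 k).trans (hu0 j).symm) hFm hFc hFl hFn (hτ k) (hτmem k)
    rcases (hk j).eq_or_lt with h | h
    · rw [heq, h, hτi j]
      rfl
    · have h1 := (hu j).pos_of_lt h_no hn ha hFm hFc hFn (hτ k) h (hτmem j) k
      rw [← heq, hτi k] at h1
      exact absurd h1 (lt_irrefl 0)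
  exact h_no ((hu k).exists_isDirichletSolution hn ha hFm hFc hFn (hτ k) hzero)

/-! ### Behaviour at infinity -/

/-- A nonnegative entire solution converges to a zero of `F`. -/
lemma IsShot.exists_tendsto (hn : 1 ≤ n) (ha : 0 ≤ a) (hu : IsShot n F a u)
    (hFm : MapsTo F (orthant L) (orthant L)) (hFc : ContinuousOn F (orthant L))
    (hmem : ∀ r, 0 ≤ r → u r ∈ orthant L) :
    ∃ l ∈ orthant L, (∀ i, l i ≤ a) ∧ Tendsto u atTop (𝓝 l) ∧ F l = 0 := by
  have hG := continuous_comp_boxProj (a := a) hFc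
  have hconv : ∀ i, ∃ l, Tendsto (fun r => u r i) atTop (𝓝 l) := by
    intro i
    have hanti : Antitone fun r : ℝ => u (max r 0) i := fun r s hrs =>
      hu.antitone hFm hFc i (le_max_right r 0 : (0 : ℝ) ≤ max r 0)
        (le_max_right s 0 : (0 : ℝ) ≤ max s 0) (max_le_max_right 0 hrs)
    have hbdd : BddBelow (range fun r : ℝ => u (max r 0) i) :=
      ⟨0, by rintro _ ⟨r, rfl⟩; exact hmem _ (le_max_right _ _) i⟩
    refine ⟨_, (tendsto_atTop_ciInf hanti hbdd).congr' ?_⟩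
    filter_upwards [eventually_ge_atTop 0] with r hr
    rw [max_eq_left hr]
  choose l hl using hconv
  have hlim : Tendsto u atTop (𝓝 l) := tendsto_pi_nhds.2 hl
  have hlmem : l ∈ orthant L := isClosed_orthant.mem_of_tendsto hlim
    ((eventually_ge_atTop 0).mono fun r hr => hmem r hr)
  have hla : ∀ i, l i ≤ a := fun i => le_of_tendsto (hl i)
    ((eventually_ge_atTop 0).mono fun r hr => hu.le hFm hFc hr i)
  refine ⟨l, hlmem, hla, hlim, ?_⟩
  funext i
  by_contra hne
  have hFl : (F ∘ boxProj L a) l = F l := by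
    rw [Function.comp_apply, boxProj_eq_self hlmem hla]
  have hpos : 0 < F l i := (hFm hlmem i).lt_of_ne (Ne.symm hne)
  obtain ⟨C, hC⟩ := exists_norm_comp_boxProj_le hFc ha
  set g : ℝ → ℝ := fun t => (F ∘ boxProj L a) (u t) i with hg
  have hgc : Continuous g := continuous_component hG u.continuous i
  have hglim : Tendsto g atTop (𝓝 (F l i)) := by
    rw [← hFl]
    exact ((continuous_apply i).tendsto _).comp ((hG.tendsto l).comp hlim)
  have hn0 : (0 : ℝ) < n := by exact_mod_cast hn
  set c := radialMean n (fun _ => F l i) 0 with hc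
  have hcpos : 0 < c := by
    have h1 : n * c = F l i := radialMean_zero (g := fun _ => F l i) hn
    by_contra! hle
    nlinarith
  have hmean : Tendsto (radialMean n g) atTop (𝓝 c) := by
    refine intervalIntegral.tendsto_integral_filter_of_dominated_convergence (fun _ => C)
      ?_ ?_ intervalIntegrable_const ?_
    · exact Eventually.of_forall fun s => Continuous.aestronglyMeasurable (by fun_prop)
    · refine Eventually.of_forall fun s => Eventually.of_forall fun θ hθ => ?_
      rw [uIoc_of_le zero_le_one] at hθ
      rw [norm_mul, norm_pow, Real.norm_of_nonneg hθ.1.le]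
      calc θ ^ (n - 1) * ‖g (s * θ)‖ ≤ 1 * ‖g (s * θ)‖ :=
            mul_le_mul_of_nonneg_right (pow_le_one₀ hθ.1.le hθ.2) (norm_nonneg _)
        _ ≤ C := by
            rw [one_mul]
            exact (norm_le_pi_norm _ i).trans (hC _)
    · refine Eventually.of_forall fun θ hθ => ?_
      rw [uIoc_of_le zero_le_one] at hθ
      exact (hglim.comp (tendsto_id.atTop_mul_const hθ.1)).const_mul _
  obtain ⟨s, hs⟩ := eventually_atTop.1 (hmean.eventually (lt_mem_nhds (half_lt_self hcpos)))
  -- beyond `max s 1` the component decreases at a rate of at least `c / 2`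
  set s₀ := max s 1 with hs₀
  have hs₀1 : 1 ≤ s₀ := le_max_right _ _
  set r := s₀ + 2 * (a + 1) / c with hr
  have hrs : s₀ ≤ r := by
    have : 0 ≤ 2 * (a + 1) / c := by positivity
    linarith
  have h1 := hu.sol.sub_apply hG (by linarith : (0 : ℝ) ≤ r) (by linarith : (0 : ℝ) ≤ s₀) i
  have h2 : ∫ _t in s₀..r, c / 2 ≤ ∫ t in s₀..r, t * radialMean n g t := by
    refine intervalIntegral.integral_mono_on hrs intervalIntegrable_const
      ((continuous_mul_radialMean hG u.continuous i).intervalIntegrable _ _) fun t ht => ?_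
    have h3 := hs t ((le_max_left _ _).trans ht.1)
    nlinarith [hs₀1.trans ht.1]
  rw [intervalIntegral.integral_const, smul_eq_mul] at h2
  have h4 : (r - s₀) * (c / 2) = a + 1 := by
    rw [hr]
    field_simp
    ring
  have h5 : u s₀ i ≤ a := hu.le hFm hFc (by linarith) i
  have h6 : 0 ≤ u r i := hmem r (by linarith) i
  linarith

end Shooting

theorem theorem2 (n L : ℕ) (hn : 1 ≤ n) (F : (Fin L → ℝ) → (Fin L → ℝ))
    (hF_maps : MapsTo F (orthant L) (orthant L))
    (hF_cont : ContinuousOn F (orthant L))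
    (hF_lip : LocallyLipschitzOn (interior (orthant L)) F)
    (hF_nondeg : NonDegenerate F)
    (h_no : ¬ ∃ R : ℝ, 0 < R ∧ ∃ w : ℝ → (Fin L → ℝ), IsDirichletSolution F R (radial n w)) :
    (∃ w : ℝ → (Fin L → ℝ), IsEntireSolution F (radial n w)) ∧
    ((∃ ε : ℝ, 0 < ε ∧ ∀ v : Fin L → ℝ, (∀ i, 0 < v i) → ‖v‖ < ε → F v ≠ 0) →
      ∃ w : ℝ → (Fin L → ℝ), IsEntireSolution F (radial n w) ∧ Tendsto w atTop (𝓝 0)) := by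
  constructor
  · obtain ⟨u, hu, hmem⟩ := exists_isShot_forall_mem_orthant hn one_pos hF_maps hF_cont hF_lip
      hF_nondeg h_no
    exact ⟨u, hu.isEntireSolution h_no hn one_pos hF_maps hF_cont hF_nondeg hmem⟩
  · rintro ⟨ε, hε, hF⟩
    have ha : 0 < ε / 2 := half_pos hε
    obtain ⟨u, hu, hmem⟩ := exists_isShot_forall_mem_orthant hn ha hF_maps hF_cont hF_lip
      hF_nondeg h_no
    refine ⟨u, hu.isEntireSolution h_no hn ha hF_maps hF_cont hF_nondeg hmem, ?_⟩
    obtain ⟨l, hl, hla, hlim, hFl⟩ := hu.exists_tendsto hn ha.le hF_maps hF_cont hmem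
    suffices l = 0 by rwa [this] at hlim
    by_contra hne
    obtain ⟨k, hk⟩ := Function.ne_iff.1 hne
    by_cases h0 : ∃ i, l i = 0
    · obtain ⟨i, -, hi⟩ := hF_nondeg.exists_pos hl h0 ⟨k, hk⟩
      rw [hFl] at hi
      exact lt_irrefl _ hi
    · push Not at h0
      refine hF l (fun i => (hl i).lt_of_ne (h0 i).symm) ?_ hFl
      refine lt_of_le_of_lt ((pi_norm_le_iff_of_nonneg ha.le).2 fun i => ?_) (half_lt_self hε)
      rw [Real.norm_of_nonneg (hl i)]
      exact hla i
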